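/- Conventions. Let $(J,g)$ be a K\"ahlerian structure on a manifold $M$: $g$ is a Riemannian metric with Levi-Civita connection $\nabla$, $J^2=-I$, $g(J\cdot,J\cdot)=g$ and $\nabla J=0$. Let $\mathcal R(U,V)=[\nabla_U,\nabla_V]-\nabla_{[U,V]}$, $R(U,V,X,Y)=g(\mathcal R(U,V)X,Y)$, $S(U,V)=\mathrm{Trace}\{X\mapsto\mathcal R(X,U)V\}$, $r=\mathrm{Trace}_g S$, and $$\mathcal R^{\mathcal H}(U,V)X=g(V,X)U-g(U,X)V+g(JV,X)JU-g(JU,X)JV-2g(JU,V)JX .$$ For $\mathcal A=\mathcal R$ or $\mathcal R^{\mathcal H}$ and a $(0,k)$-tensor field $T$, put $(\mathcal A\cdot T)(U,V,X_1,\dots,X_k)=-\sum_s T(X_1,\dots,\mathcal A(U,V)X_s,\dots,X_k)$. The structure is semisymmetric if $\mathcal R\cdot R=0$, and holomorphically pseudosymmetric (resp. holomorphically Ricci-pseudosymmetric) with structure function $f$ if $\mathcal R\cdot R=f\,\mathcal R^{\mathcal H}\cdot R$ (resp. $\mathcal R\cdot S=f\,\mathcal R^{\mathcal H}\cdot S$).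 Setting. Let $m\ge 1$, let $(x^\alpha,y^\alpha,z,t)$, $1\le\alpha\le m$, be the Cartesian coordinates of $\mathbb R^{2m+2}$, let $N\subset\mathbb R^{2m+1}$ be open, connected and non-empty, let $0\le A<B<\infty$ and $M=N\times(A,B)$. For a smooth function $h:(A,B)\to\mathbb R$ without zeros let, with $\alpha'=\alpha+m$, $$e_\alpha=\tfrac1t\partial_{x^\alpha},\quad e_{\alpha'}=\tfrac1t(\partial_{y^\alpha}+2x^\alpha\partial_z),\quad e_{2m+1}=\tfrac1{t^2h}\partial_z,\quad e_{2m+2}=th\,\partial_t ,$$ let $g$ be the metric for which $(e_i)$ is orthonormal, and let $Je_\alpha=e_{\alpha'}$, $Je_{\alpha'}=-e_\alpha$, $Je_{2m+1}=e_{2m+2}$, $Je_{2m+2}=-e_{2m+1}$. The dual frame is $$\theta^\alpha=t\,dx^\alpha,\quad \theta^{\alpha'}=t\,dy^\alpha,\quad \theta^{2m+1}=t^2h\Big(dz-2\sum_\lambda x^\lambda dy^\lambda\Big),\quad \theta^{2m+2}=\tfrac1{th}dt ,$$ and $g=\sum_i\theta^i\otimes\theta^i$. Claim. $M$ is open, connected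 and not compact, and the following hold. 1. For every such $h$, $(J,g)$ is a K\"ahlerian structure on $M$ that is holomorphically pseudosymmetric with structure function $f=-h(h+th')$. Moreover $$(\mathcal R\cdot R)(e_\alpha,e_{2m+1},e_\alpha,e_\beta,e_\beta,e_{2m+1})=th^2h'(h+th')\quad(\alpha\ne\beta),$$ $$(\mathcal R\cdot R)(e_\alpha,e_{2m+1},e_\alpha,e_{\alpha'},e_{\alpha'},e_{2m+1})=4th^2h'(h+th').$$ 2. The structure is in general not semisymmetric: for all $m,N,A,B$ there is such an $h$ for which it is not. 3. Let $a,b,c\in\mathbb R$ with $a+bt^2+ct^{4+2m}>0$ on $(A,B)$ and $h(t)=t^{-(2+m)}\sqrt{a+bt^2+ct^{4+2m}}$. Then $h$ is smooth without zeros on $(A,B)$, the scalar curvature is the constant $r=-4c(m+1)(m+2)$, and $f=t^{-(4+2m)}\big(a(m+1)+bmt^2-ct^{4+2m}\big)$. In particular: (i) for $a=c=0$, $b=1$: $r=0$ and $f=m/t^{2m+2}>0$; (ii) for $a=1$, $b=c=0$: $r=0$ and $f=(m+1)/t^{2m+4}>0$; (iii) for $a>0$, $b=0$, $c=-a$ and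 $B\le 1$: $r=4a(m+1)(m+2)$ and $f=a\big(1+(m+1)/t^{2m+4}\big)>0$. None of these structures (i)--(iii) is semisymmetric; in cases (ii) and (iii) the metric is Einstein. 4. Consequently compactness cannot be dropped in the theorems that a compact K\"ahlerian manifold of constant scalar curvature is Ricci-symmetric ($\nabla S=0$) if it is holomorphically Ricci-pseudosymmetric with $f\ge0$, and locally symmetric ($\nabla R=0$) if it is holomorphically pseudosymmetric with $f\ge 0$: on every non-compact $M$ as above there is a K\"ahlerian structure with constant scalar curvature that is holomorphically pseudosymmetric and holomorphically Ricci-pseudosymmetric with a common structure function $f>0$, and for which $\nabla S\ne0$ and $\nabla R\neq0$. -/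

import Mathlib

open Set
open scoped ContDiff

set_option maxSynthPendingDepth 3

noncomputable section

namespace KahlerExample

/-! ### Riemannian geometry in a global chart

`E` is a finite-dimensional real vector space, used as a global chart. Vector fields are maps
`E → E`, a metric is a map `g : E → E →L[ℝ] E →L[ℝ] ℝ`, a `(1,1)`-tensor field is a map
`J : E → E →L[ℝ] E`, and a `(0,k)`-tensor field is a map `T : E → (Fin k → E) → ℝ`.
All conditions are imposed only at the points of an open set `M`, so the values of these
objects outside `M` play no role. -/

section Chart

variable {E : Type*} [NormedAddCommGroup E] [NormedSpace ℝ E]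

/-- The Koszul form (Christoffel symbols of the first kind):
`koszul g p u v w = ½ (∂_u g(v,w) + ∂_v g(u,w) - ∂_w g(u,v))`; see `koszul_apply`. -/
def koszul (g : E → E →L[ℝ] E →L[ℝ] ℝ) (p : E) : E →L[ℝ] E →L[ℝ] E →L[ℝ] ℝ :=
  (1 / 2 : ℝ) • (fderiv ℝ g p + (fderiv ℝ g p).flip
    - (ContinuousLinearMap.flipₗᵢ ℝ E E ℝ).toContinuousLinearEquiv.toContinuousLinearMap ∘L
        (fderiv ℝ g p).flip)

theorem koszul_apply (g : E → E →L[ℝ] E →L[ℝ] ℝ) (p u v w : E) :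
    koszul g p u v w =
      1 / 2 * (fderiv ℝ g p u v w + fderiv ℝ g p v u w - fderiv ℝ g p w u v) := by
  simp [koszul]

/-- The Christoffel symbols `Γ_p(u,v)` of the Levi-Civita connection: the vector dual, with
respect to `g p`, to the Koszul form `koszul g p u v`. -/
def christoffel (g : E → E →L[ℝ] E →L[ℝ] ℝ) (p : E) : E →L[ℝ] E →L[ℝ] E :=
  (ContinuousLinearMap.compL ℝ E (E →L[ℝ] ℝ) E (g p).inverse) ∘L (koszul g p)

theorem christoffel_apply (g : E → E →L[ℝ] E →L[ℝ] ℝ) (p u v : E) :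
    christoffel g p u v = (g p).inverse (koszul g p u v) := by
  simp [christoffel]

/-- The Levi-Civita connection on vector fields, `∇_X Y = ∂_X Y + Γ(X,Y)`. -/
def nabla (g : E → E →L[ℝ] E →L[ℝ] ℝ) (X Y : E → E) : E → E :=
  fun p => fderiv ℝ Y p (X p) + christoffel g p (X p) (Y p)

/-- The curvature operator `R(u,v)w` of `[∇_U,∇_V] - ∇_[U,V]` at `p`, written out for the
constant extensions of `u`, `v`, `w`. -/
def curv (g : E → E →L[ℝ] E →L[ℝ] ℝ) (p u v w : E) : E :=
  fderiv ℝ (christoffel g) p u v w - fderiv ℝ (christoffel g) p v u w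
    + christoffel g p u (christoffel g p v w) - christoffel g p v (christoffel g p u w)

/-- The Riemann tensor `R(U,V,X,Y) = g(R(U,V)X,Y)` as a `(0,4)`-tensor field. -/
def riemann (g : E → E →L[ℝ] E →L[ℝ] ℝ) (p : E) (X : Fin 4 → E) : ℝ :=
  g p (curv g p (X 0) (X 1) (X 2)) (X 3)

/-- The endomorphism `X ↦ R(X,u)v`. -/
def curvEndo (g : E → E →L[ℝ] E →L[ℝ] ℝ) (p u v : E) : E →ₗ[ℝ] E where
  toFun x := curv g p x u v
  map_add' x y := by simp only [curv, map_add, add_apply]; abel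
  map_smul' c x := by
    simp only [curv, map_smul, smul_apply, RingHom.id_apply, smul_sub, smul_add]

/-- The Ricci tensor `S(u,v) = Trace {X ↦ R(X,u)v}`. -/
def ricci (g : E → E →L[ℝ] E →L[ℝ] ℝ) (p : E) : E →ₗ[ℝ] E →ₗ[ℝ] ℝ :=
  LinearMap.mk₂ ℝ (fun u v => LinearMap.trace ℝ E (curvEndo g p u v))
    (fun u u' v => by
      rw [← map_add]; congr 1; ext x
      simp only [curvEndo, curv, map_add, add_apply, LinearMap.coe_mk,
        AddHom.coe_mk, LinearMap.add_apply]; abel)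
    (fun c u v => by
      rw [← map_smul]; congr 1; ext x
      simp only [curvEndo, curv, map_smul, smul_apply, LinearMap.coe_mk,
        AddHom.coe_mk, LinearMap.smul_apply, smul_sub, smul_add])
    (fun u v v' => by
      rw [← map_add]; congr 1; ext x
      simp only [curvEndo, curv, map_add, LinearMap.coe_mk,
        AddHom.coe_mk, LinearMap.add_apply]; abel)
    (fun c u v => by
      rw [← map_smul]; congr 1; ext x
      simp only [curvEndo, curv, map_smul, LinearMap.coe_mk,
        AddHom.coe_mk, LinearMap.smul_apply, smul_sub, smul_add])

/-- The Ricci tensor as a `(0,2)`-tensor field. -/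
def ricciTensor (g : E → E →L[ℝ] E →L[ℝ] ℝ) (p : E) (X : Fin 2 → E) : ℝ :=
  ricci g p (X 0) (X 1)

/-- The scalar curvature: the trace of the Ricci endomorphism `u ↦ (g p)⁻¹ (S(u,·))`. -/
def scalarCurvature [FiniteDimensional ℝ E] (g : E → E →L[ℝ] E →L[ℝ] ℝ) (p : E) : ℝ :=
  LinearMap.trace ℝ E
    (((g p).inverse : (E →L[ℝ] ℝ) →ₗ[ℝ] E) ∘ₗ
      (LinearMap.toContinuousLinearMap : (E →ₗ[ℝ] ℝ) ≃ₗ[ℝ] (E →L[ℝ] ℝ)).toLinearMap ∘ₗ ricci g p)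

/-- The covariant derivative `(∇_u T)(X₁,…,X_k)` of a `(0,k)`-tensor field. -/
def nablaTensor {k : ℕ} (g : E → E →L[ℝ] E →L[ℝ] ℝ) (T : E → (Fin k → E) → ℝ)
    (p u : E) (X : Fin k → E) : ℝ :=
  fderiv ℝ (fun q => T q X) p u
    - ∑ s, T p (Function.update X s (christoffel g p u (X s)))

/-- `T` is parallel on `M`: `∇T = 0`. -/
def IsParallelOn {k : ℕ} (M : Set E) (g : E → E →L[ℝ] E →L[ℝ] ℝ)
    (T : E → (Fin k → E) → ℝ) : Prop :=
  ∀ p ∈ M, ∀ (u : E) (X : Fin k → E), nablaTensor g T p u X = 0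

/-- Ricci-symmetric: `∇S = 0`. -/
def IsRicciSymmetricOn (M : Set E) (g : E → E →L[ℝ] E →L[ℝ] ℝ) : Prop :=
  IsParallelOn M g (ricciTensor g)

/-- Locally symmetric: `∇R = 0`. -/
def IsLocallySymmetricOn (M : Set E) (g : E → E →L[ℝ] E →L[ℝ] ℝ) : Prop :=
  IsParallelOn M g (riemann g)

/-- Einstein: `S = λ g` for a constant `λ`. -/
def IsEinsteinOn (M : Set E) (g : E → E →L[ℝ] E →L[ℝ] ℝ) : Prop :=
  ∃ l : ℝ, ∀ p ∈ M, ∀ u v : E, ricci g p u v = l * g p u v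

/-- `(J, g)` is a Kählerian structure on the open set `M`: `g` is a Riemannian metric, `J` is an
almost complex structure, `g(J·,J·) = g` and `∇J = 0`, that is, `∇_X (JY) = J ∇_X Y` for all
smooth vector fields `X`, `Y` on `M`. -/
structure IsKahlerOn (M : Set E) (J : E → E →L[ℝ] E) (g : E → E →L[ℝ] E →L[ℝ] ℝ) : Prop where
  smooth_metric : ContDiffOn ℝ ∞ g M
  smooth_complex : ContDiffOn ℝ ∞ J M
  symm : ∀ p ∈ M, ∀ u v : E, g p u v = g p v u
  pos : ∀ p ∈ M, ∀ u : E, u ≠ 0 → 0 < g p u u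
  sq_eq_neg : ∀ p ∈ M, ∀ u : E, J p (J p u) = -u
  hermitian : ∀ p ∈ M, ∀ u v : E, g p (J p u) (J p v) = g p u v
  parallel : ∀ X Y : E → E, ContDiffOn ℝ ∞ X M → ContDiffOn ℝ ∞ Y M →
    ∀ p ∈ M, nabla g X (fun q => J q (Y q)) p = J p (nabla g X Y p)

/-- The curvature-type operator `R^H(u,v)x` of a Hermitian structure. -/
def curvH (J : E → E →L[ℝ] E) (g : E → E →L[ℝ] E →L[ℝ] ℝ) (p u v x : E) : E :=
  g p v x • u - g p u x • v + g p (J p v) x • J p u - g p (J p u) x • J p v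
    - (2 * g p (J p u) v) • J p x

/-- The action of an operator `A` on a `(0,k)`-tensor as a derivation of the tensor algebra:
`(A · T)(X₁,…,X_k) = -∑ₛ T(X₁,…,A Xₛ,…,X_k)`. -/
def derivationAct {k : ℕ} (A : E → E) (T : (Fin k → E) → ℝ) (X : Fin k → E) : ℝ :=
  -∑ s, T (Function.update X s (A (X s)))

/-- `(R · T)(U,V,X₁,…,X_k)` at `p`. -/
def curvDot {k : ℕ} (g : E → E →L[ℝ] E →L[ℝ] ℝ) (T : E → (Fin k → E) → ℝ)
    (p U V : E) (X : Fin k → E) : ℝ :=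
  derivationAct (curv g p U V) (T p) X

/-- `(R^H · T)(U,V,X₁,…,X_k)` at `p`. -/
def curvHDot {k : ℕ} (J : E → E →L[ℝ] E) (g : E → E →L[ℝ] E →L[ℝ] ℝ)
    (T : E → (Fin k → E) → ℝ) (p U V : E) (X : Fin k → E) : ℝ :=
  derivationAct (curvH J g p U V) (T p) X

/-- The manifold is semisymmetric: `R · R = 0` on `M`. -/
def IsSemisymmetricOn (M : Set E) (g : E → E →L[ℝ] E →L[ℝ] ℝ) : Prop :=
  ∀ p ∈ M, ∀ (U V : E) (X : Fin 4 → E), curvDot g (riemann g) p U V X = 0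

/-- Holomorphic pseudosymmetry with structure function `f`: `R · R = f R^H · R` on `M`. -/
def IsHolPseudosymmetricOn (M : Set E) (J : E → E →L[ℝ] E) (g : E → E →L[ℝ] E →L[ℝ] ℝ)
    (f : E → ℝ) : Prop :=
  ∀ p ∈ M, ∀ (U V : E) (X : Fin 4 → E),
    curvDot g (riemann g) p U V X = f p * curvHDot J g (riemann g) p U V X

/-- Holomorphic Ricci-pseudosymmetry with structure function `f`: `R · S = f R^H · S` on `M`. -/
def IsHolRicciPseudosymmetricOn (M : Set E) (J : E → E →L[ℝ] E)
    (g : E → E →L[ℝ] E →L[ℝ] ℝ) (f : E → ℝ) : Prop :=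
  ∀ p ∈ M, ∀ (U V : E) (X : Fin 2 → E),
    curvDot g (ricciTensor g) p U V X = f p * curvHDot J g (ricciTensor g) p U V X

end Chart

/-! ### The example -/

/-- `ℝ^{2m+2}` with coordinates `(x, y, z, t)`. -/
abbrev Space (m : ℕ) : Type := (Fin m → ℝ) × (Fin m → ℝ) × ℝ × ℝ

/-- The coordinate `t` of a point. -/
abbrev tCoord {m : ℕ} (p : Space m) : ℝ := p.2.2.2

/-- `M = N × (A,B)`. -/
def domain {m : ℕ} (N : Set ((Fin m → ℝ) × (Fin m → ℝ) × ℝ)) (A B : ℝ) : Set (Space m) :=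
  {p | (p.1, p.2.1, p.2.2.1) ∈ N ∧ tCoord p ∈ Ioo A B}

/-- Frame indices, in the order `1,…,m`, `1',…,m'`, `2m+1`, `2m+2`. -/
abbrev Idx (m : ℕ) : Type := Fin m ⊕ Fin m ⊕ Fin 2

/-- The index `α`. -/
abbrev ix {m : ℕ} (α : Fin m) : Idx m := Sum.inl α

/-- The index `α' = α + m`. -/
abbrev iy {m : ℕ} (α : Fin m) : Idx m := Sum.inr (Sum.inl α)

/-- The index `2m+1`. -/
abbrev iz {m : ℕ} : Idx m := Sum.inr (Sum.inr 0)

/-- The index `2m+2`. -/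
abbrev it {m : ℕ} : Idx m := Sum.inr (Sum.inr 1)

/-- The frame: `(1/t) ∂_{x^α}`, `(1/t) (∂_{y^α} + 2 x^α ∂_z)`, `(1/(t² h)) ∂_z`, `t h ∂_t`. -/
def frame {m : ℕ} (h : ℝ → ℝ) : Idx m → Space m → Space m
  | Sum.inl α, p => (Pi.single α (1 / tCoord p), 0, 0, 0)
  | Sum.inr (Sum.inl α), p => (0, Pi.single α (1 / tCoord p), 1 / tCoord p * (2 * p.1 α), 0)
  | Sum.inr (Sum.inr 0), p => (0, 0, 1 / (tCoord p ^ 2 * h (tCoord p)), 0)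
  | Sum.inr (Sum.inr 1), p => (0, 0, 0, tCoord p * h (tCoord p))

/-- The coordinate differential `dx^α`. -/
def dx {m : ℕ} (α : Fin m) : Space m →L[ℝ] ℝ :=
  ContinuousLinearMap.proj α ∘L ContinuousLinearMap.fst ℝ _ _

/-- The coordinate differential `dy^α`. -/
def dy {m : ℕ} (α : Fin m) : Space m →L[ℝ] ℝ :=
  ContinuousLinearMap.proj α ∘L ContinuousLinearMap.fst ℝ _ _ ∘L ContinuousLinearMap.snd ℝ _ _

/-- The coordinate differential `dz`. -/
def dz {m : ℕ} : Space m →L[ℝ] ℝ :=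
  ContinuousLinearMap.fst ℝ _ _ ∘L ContinuousLinearMap.snd ℝ _ _ ∘L ContinuousLinearMap.snd ℝ _ _

/-- The coordinate differential `dt`. -/
def dt {m : ℕ} : Space m →L[ℝ] ℝ :=
  ContinuousLinearMap.snd ℝ _ _ ∘L ContinuousLinearMap.snd ℝ _ _ ∘L ContinuousLinearMap.snd ℝ _ _

/-- The dual frame: `t dx^α`, `t dy^α`, `t² h (-2 ∑ x^λ dy^λ + dz)`, `(1/(t h)) dt`. -/
def coframe {m : ℕ} (h : ℝ → ℝ) : Idx m → Space m → Space m →L[ℝ] ℝ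
  | Sum.inl α, p => tCoord p • dx α
  | Sum.inr (Sum.inl α), p => tCoord p • dy α
  | Sum.inr (Sum.inr 0), p =>
      (tCoord p ^ 2 * h (tCoord p)) • (-(2 : ℝ) • ∑ l, p.1 l • dy l + dz)
  | Sum.inr (Sum.inr 1), p => (1 / (tCoord p * h (tCoord p))) • dt

/-- The vector fields `J e_i`: `J e_α = e_α'`, `J e_α' = -e_α`, `J e_{2m+1} = e_{2m+2}`,
`J e_{2m+2} = -e_{2m+1}`. -/
def rotatedFrame {m : ℕ} (h : ℝ → ℝ) : Idx m → Space m → Space m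
  | Sum.inl α, p => frame h (iy α) p
  | Sum.inr (Sum.inl α), p => -frame h (ix α) p
  | Sum.inr (Sum.inr 0), p => frame h it p
  | Sum.inr (Sum.inr 1), p => -frame h iz p

/-- The metric `g = ∑ θ^i ⊗ θ^i`. -/
def metric {m : ℕ} (h : ℝ → ℝ) (p : Space m) : Space m →L[ℝ] Space m →L[ℝ] ℝ :=
  ∑ i, (coframe h i p).smulRight (coframe h i p)

/-- The almost complex structure `J = ∑ θ^i ⊗ J e_i`. -/
def complexStr {m : ℕ} (h : ℝ → ℝ) (p : Space m) : Space m →L[ℝ] Space m :=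
  ∑ i, (coframe h i p).smulRight (rotatedFrame h i p)

/-- The structure function `f = -h (h + t h')`, as a function of the coordinate `t`. -/
def structureFun (h : ℝ → ℝ) (t : ℝ) : ℝ := -(h t * (h t + t * deriv h t))

/-- `h` is a smooth function without zeros on `(A,B)`. -/
def Admissible (h : ℝ → ℝ) (A B : ℝ) : Prop :=
  ContDiffOn ℝ ∞ h (Ioo A B) ∧ ∀ t ∈ Ioo A B, h t ≠ 0

/-- The function `h(t) = t^{-(2+m)} √(a + b t² + c t^{4+2m})`. -/
def profile (m : ℕ) (a b c : ℝ) (t : ℝ) : ℝ :=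
  1 / t ^ (2 + m) * √(a + b * t ^ 2 + c * t ^ (4 + 2 * m))

end KahlerExample

end

open KahlerExample

open KahlerExample

/-!
The metric is studied in its orthonormal frame. The coframe is regarded as a field `Θ = frameMap`
of linear isomorphisms onto a fixed Hermitian vector space, on which the metric and the complex
structure are constant. If `Ω` is skew and satisfies the first structure equation
`dΘ + Ω ∧ Θ = 0`, then the Levi-Civita connection is `d + Ω` and the curvature is `dΩ + Ω ∧ Ω`
(`IsMovingFrameOn.frame_christoffel`, `IsMovingFrameOn.frame_curv`). For the present metric
`Ω = connForm` is an explicit algebraic expression in `Θ`, with coefficients `h` and `h + t h'`.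
It commutes with the complex structure, whence `∇J = 0`.

Let `H` be the span of the `e_α`, `e_α'` and `V` the span of `e_{2m+1}`, `e_{2m+2}`. The second
structure equation gives (`connection_curvature`, `frameMap_curv`)
`R = f R^H + μ R^H_H + ν R^H_V`, with `f = -h (h + t h')`, `μ = t h h'` and
`ν = -(3 t h h' + t² (h h')') / 4`, where the last two terms are the operators `R^H` of the two
summands `H` and `V`. Hence `R(U,V) - f R^H(U,V)` is skew, commutes with `J` and preserves the
splitting. It therefore annihilates, as a derivation, every tensor that is a polynomial in `g`, `J`
and the projections onto the summands, such as the Riemann and the Ricci tensor. This is the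
holomorphic (Ricci-)pseudosymmetry with structure function `f`
(`derivationAct_splitCurv_modelRiemann`, `splitForm_splitCurv`). The components of `R · R` in the
frame are `-f μ` and `-4 f μ`, so the structure is not semisymmetric where `f` and `h'` do not
vanish.

Contraction (`trace_modelCurv`) gives `S = σ g_H + τ g_V` with `σ = 2 (m+2) f + 2 (m+1) μ` and
`τ = 2 (m+2) f + 4 ν`. These functions depend on `h` only through `h²`, which for the profiles
considered is `a t^{-(4+2m)} + b t^{-(2+2m)} + c`. This gives `σ = -2c(m+2) - 2b t^{-(2+2m)}` and
`τ = -2c(m+2) + 2mb t^{-(2+2m)}`, so that the scalar curvature is constant, and the metric is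
Einstein for `b = 0`. For `a = c = 0`, `b = 1` the function `σ` is not constant along the curves
with tangent `∂_t`, on which the frame is parallel, so `∇S ≠ 0`. In this case `f / h² = m`, and
`(∇R)(∂_t; ∂_x, ∂_t, ∂_t, ∂_x) = 2 m h' / h` does not vanish either.
-/

namespace KahlerExample

/-! ### Moving frames -/

section MovingFrame

variable {E F : Type*} [NormedAddCommGroup E] [NormedSpace ℝ E] [NormedAddCommGroup F]
  [NormedSpace ℝ F]

/-- A moving frame on the open set `M`, with its connection form. The frame is a field `Θ` of
linear isomorphisms from the tangent spaces to a fixed vector space `F` which carries the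
nondegenerate symmetric form `β`, and the metric is the pullback of `β`. The connection form `Ω`
takes values in the endomorphisms of `F` that are skew for `β`, and satisfies the first structure
equation `dΘ + Ω ∧ Θ = 0` (the connection is torsion-free). -/
structure IsMovingFrameOn (M : Set E) (g : E → E →L[ℝ] E →L[ℝ] ℝ) (β : F →L[ℝ] F →L[ℝ] ℝ)
    (Θ : E → E →L[ℝ] F) (Ω : E → E →L[ℝ] F →L[ℝ] F) : Prop where
  isOpen : IsOpen M
  smooth_metric : ContDiffOn ℝ ∞ g M
  smooth_frame : ContDiffOn ℝ ∞ Θ M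
  differentiable_form : ∀ p ∈ M, DifferentiableAt ℝ Ω p
  symm : ∀ a b, β a b = β b a
  nondegenerate : ∀ a, (∀ b, β a b = 0) → a = 0
  metric_eq : ∀ p ∈ M, ∀ u v, g p u v = β (Θ p u) (Θ p v)
  bijective : ∀ p ∈ M, Function.Bijective (Θ p)
  skew : ∀ p ∈ M, ∀ u a b, β (Ω p u a) b = -β a (Ω p u b)
  torsion_free : ∀ p ∈ M, ∀ u v,
    fderiv ℝ Θ p u v + Ω p u (Θ p v) = fderiv ℝ Θ p v u + Ω p v (Θ p u)

namespace IsMovingFrameOn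

variable {M : Set E} {g : E → E →L[ℝ] E →L[ℝ] ℝ} {β : F →L[ℝ] F →L[ℝ] ℝ}
  {Θ : E → E →L[ℝ] F} {Ω : E → E →L[ℝ] F →L[ℝ] F} {p : E}

theorem contDiffAt_frame (H : IsMovingFrameOn M g β Θ Ω) (hp : p ∈ M) : ContDiffAt ℝ ∞ Θ p :=
  H.smooth_frame.contDiffAt (H.isOpen.mem_nhds hp)

theorem contDiffAt_metric (H : IsMovingFrameOn M g β Θ Ω) (hp : p ∈ M) : ContDiffAt ℝ ∞ g p :=
  H.smooth_metric.contDiffAt (H.isOpen.mem_nhds hp)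

theorem differentiableAt_frame (H : IsMovingFrameOn M g β Θ Ω) (hp : p ∈ M) :
    DifferentiableAt ℝ Θ p :=
  (H.contDiffAt_frame hp).differentiableAt (by simp)

theorem differentiableAt_metric (H : IsMovingFrameOn M g β Θ Ω) (hp : p ∈ M) :
    DifferentiableAt ℝ g p :=
  (H.contDiffAt_metric hp).differentiableAt (by simp)

/-- The product rule for `g = β(Θ ·, Θ ·)`. -/
theorem fderiv_metric (H : IsMovingFrameOn M g β Θ Ω) (hp : p ∈ M) (u v w : E) :
    fderiv ℝ g p u v w =
      β (fderiv ℝ Θ p u v) (Θ p w) + β (Θ p v) (fderiv ℝ Θ p u w) := by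
  have h1 : HasFDerivAt (fun q => g q v w) _ p :=
    ((H.differentiableAt_metric hp).hasFDerivAt.clm_apply (hasFDerivAt_const v p)).clm_apply
      (hasFDerivAt_const w p)
  have hΘ (x : E) : HasFDerivAt (fun q => Θ q x) _ p :=
    (H.differentiableAt_frame hp).hasFDerivAt.clm_apply (hasFDerivAt_const x p)
  have h2 : HasFDerivAt (fun q => β (Θ q v) (Θ q w)) _ p :=
    (β.hasFDerivAt.comp p (hΘ v)).clm_apply (hΘ w)
  have h3 : (fun q => g q v w) =ᶠ[nhds p] fun q => β (Θ q v) (Θ q w) := by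
    filter_upwards [H.isOpen.mem_nhds hp] with q hq using H.metric_eq q hq v w
  have h4 := congrArg (fun L => L u) (h1.unique (h2.congr_of_eventuallyEq h3))
  simpa [add_comm] using h4

theorem metric_injective (H : IsMovingFrameOn M g β Θ Ω) (hp : p ∈ M) :
    Function.Injective (g p) := by
  refine (injective_iff_map_eq_zero _).2 fun u hu => ?_
  refine (injective_iff_map_eq_zero _).1 (H.bijective p hp).1 u (H.nondegenerate _ fun b => ?_)
  obtain ⟨v, rfl⟩ := (H.bijective p hp).2 b
  rw [← H.metric_eq p hp, hu]
  rfl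

variable [FiniteDimensional ℝ E]

theorem metric_isInvertible (H : IsMovingFrameOn M g β Θ Ω) (hp : p ∈ M) :
    (g p).IsInvertible := by
  have hfin : Module.finrank ℝ E = Module.finrank ℝ (E →L[ℝ] ℝ) := by
    rw [← (LinearMap.toContinuousLinearMap : (E →ₗ[ℝ] ℝ) ≃ₗ[ℝ] (E →L[ℝ] ℝ)).finrank_eq,
      Subspace.dual_finrank_eq]
  let e := LinearEquiv.ofInjectiveOfFinrankEq (g p : E →ₗ[ℝ] E →L[ℝ] ℝ)
    (H.metric_injective hp) hfin
  exact ⟨e.toContinuousLinearEquiv, by ext; rfl⟩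

theorem inverse_metric_apply (H : IsMovingFrameOn M g β Θ Ω) (hp : p ∈ M) (u : E) :
    (g p).inverse (g p u) = u := by
  obtain ⟨e, he⟩ := H.metric_isInvertible hp
  rw [← he, ContinuousLinearMap.inverse_equiv]
  exact e.symm_apply_apply u

/-- In a moving frame the Levi-Civita connection is `d + Ω`. -/
theorem frame_christoffel (H : IsMovingFrameOn M g β Θ Ω) (hp : p ∈ M) (u v : E) :
    Θ p (christoffel g p u v) = fderiv ℝ Θ p u v + Ω p u (Θ p v) := by
  obtain ⟨w, hw⟩ := (H.bijective p hp).2 (fderiv ℝ Θ p u v + Ω p u (Θ p v))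
  -- It suffices to check the Koszul formula for `w`, because `g p` is nondegenerate.
  suffices h : koszul g p u v = g p w by
    rw [christoffel_apply, h, H.inverse_metric_apply hp, hw]
  ext x
  have hsk := H.skew p hp
  -- Torsion-freeness and skewness, each paired with the third vector, add up to the formula.
  have e1 := congrArg (fun a => β a (Θ p x)) (H.torsion_free p hp u v)
  have e2 := congrArg (fun a => β a (Θ p v)) (H.torsion_free p hp u x)
  have e3 := congrArg (fun a => β a (Θ p u)) (H.torsion_free p hp v x)
  simp only [map_add, add_apply] at e1 e2 e3
  rw [koszul_apply, H.metric_eq p hp, hw, H.fderiv_metric hp, H.fderiv_metric hp,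
    H.fderiv_metric hp, map_add, add_apply]
  rw [H.symm (Θ p v) (fderiv ℝ Θ p u x), H.symm (Θ p u) (fderiv ℝ Θ p v x),
    H.symm (Θ p u) (fderiv ℝ Θ p x v)]
  have s1 := hsk u (Θ p v) (Θ p x)
  have s2 := hsk v (Θ p u) (Θ p x)
  have s3 := hsk x (Θ p u) (Θ p v)
  rw [H.symm (Θ p v)] at s1
  rw [H.symm (Θ p u)] at s2 s3
  linear_combination (1 / 2) * (-e1 + e2 + e3 - s1 - s2 + s3)

theorem differentiableAt_christoffel (H : IsMovingFrameOn M g β Θ Ω) (hp : p ∈ M) :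
    DifferentiableAt ℝ (christoffel g) p := by
  have : CompleteSpace E := FiniteDimensional.complete ℝ E
  have hg := H.contDiffAt_metric hp
  have h1 : DifferentiableAt ℝ (fun q => (g q).inverse) p :=
    ((H.metric_isInvertible hp).contDiffAt_map_inverse (n := ∞)).differentiableAt (by simp)
      |>.comp p (H.differentiableAt_metric hp)
  have h2 : DifferentiableAt ℝ (fderiv ℝ g) p :=
    (hg.fderiv_right (m := ∞) (by simp)).differentiableAt (by simp)
  have h3 : DifferentiableAt ℝ (fun q => (fderiv ℝ g q).flip) p :=
    (ContinuousLinearMap.flipₗᵢ ℝ E E (E →L[ℝ] ℝ)).toContinuousLinearEquiv.toContinuousLinearMap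
      |>.differentiableAt.comp p h2
  have h4 : DifferentiableAt ℝ (koszul g) p := by
    unfold koszul
    exact ((h2.add h3).sub ((differentiableAt_const _).clm_comp h3)).const_smul (1 / 2 : ℝ)
  unfold christoffel
  exact (((ContinuousLinearMap.compL ℝ E (E →L[ℝ] ℝ) E).differentiableAt).comp p h1).clm_comp h4

/-- The product rule applied to `frame_christoffel`. -/
theorem frame_fderiv_christoffel (H : IsMovingFrameOn M g β Θ Ω) (hp : p ∈ M) (x u v : E) :
    Θ p (fderiv ℝ (christoffel g) p x u v) =
      fderiv ℝ (fderiv ℝ Θ) p x u v + fderiv ℝ Ω p x u (Θ p v) + Ω p u (fderiv ℝ Θ p x v)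
        - fderiv ℝ Θ p x (christoffel g p u v) := by
  have hΘ := (H.differentiableAt_frame hp).hasFDerivAt
  have hDΘ : HasFDerivAt (fderiv ℝ Θ) _ p :=
    (((H.contDiffAt_frame hp).fderiv_right (m := ∞) (by simp)).differentiableAt
      (by simp)).hasFDerivAt
  have hΓ : HasFDerivAt (fun q => christoffel g q u v) _ p :=
    ((H.differentiableAt_christoffel hp).hasFDerivAt.clm_apply (hasFDerivAt_const u p)).clm_apply
      (hasFDerivAt_const v p)
  have h1 : HasFDerivAt (fun q => Θ q (christoffel g q u v)) _ p := hΘ.clm_apply hΓ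
  have h2 : HasFDerivAt (fun q => fderiv ℝ Θ q u v) _ p :=
    (hDΘ.clm_apply (hasFDerivAt_const u p)).clm_apply (hasFDerivAt_const v p)
  have h3 : HasFDerivAt (fun q => Ω q u (Θ q v)) _ p :=
    ((H.differentiable_form p hp).hasFDerivAt.clm_apply (hasFDerivAt_const u p)).clm_apply
      (hΘ.clm_apply (hasFDerivAt_const v p))
  have h4 : (fun q => Θ q (christoffel g q u v)) =ᶠ[nhds p]
      fun q => fderiv ℝ Θ q u v + Ω q u (Θ q v) := by
    filter_upwards [H.isOpen.mem_nhds hp] with q hq using H.frame_christoffel hq u v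
  have h5 := congrArg (fun L => L x) (h1.unique ((h2.add h3).congr_of_eventuallyEq h4))
  simp at h5
  rw [eq_sub_iff_add_eq, h5]
  abel

/-- The second structure equation: in a moving frame the curvature is `dΩ + Ω ∧ Ω`. -/
theorem frame_curv (H : IsMovingFrameOn M g β Θ Ω) (hp : p ∈ M) (u v w : E) :
    Θ p (curv g p u v w) = fderiv ℝ Ω p u v (Θ p w) - fderiv ℝ Ω p v u (Θ p w)
      + Ω p u (Ω p v (Θ p w)) - Ω p v (Ω p u (Θ p w)) := by
  -- The second derivatives of `Θ` cancel by symmetry.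
  have hs : IsSymmSndFDerivAt ℝ Θ p :=
    (H.contDiffAt_frame hp).isSymmSndFDerivAt (by simpa using ENat.LEInfty.out)
  have hs' : fderiv ℝ (fderiv ℝ Θ) p u v = fderiv ℝ (fderiv ℝ Θ) p v u := hs u v
  simp only [curv, map_add, map_sub, H.frame_fderiv_christoffel hp, H.frame_christoffel hp, hs']
  abel

/-- The covariant derivative of a vector field in a moving frame. -/
theorem frame_nabla (H : IsMovingFrameOn M g β Θ Ω) (hp : p ∈ M) (X : E → E) {Y : E → E}
    (hY : DifferentiableAt ℝ Y p) :
    Θ p (nabla g X Y p) = fderiv ℝ (fun q => Θ q (Y q)) p (X p) + Ω p (X p) (Θ p (Y p)) := by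
  have h : HasFDerivAt (fun q => Θ q (Y q)) _ p :=
    (H.differentiableAt_frame hp).hasFDerivAt.clm_apply hY.hasFDerivAt
  rw [h.fderiv, nabla, map_add, H.frame_christoffel hp]
  simp
  abel

/-- A field of endomorphisms that has constant matrix `J₀` in a moving frame, where `J₀` commutes
with the connection form, is parallel. -/
theorem nabla_endomorphism (H : IsMovingFrameOn M g β Θ Ω) {J : E → E →L[ℝ] E} {J₀ : F →L[ℝ] F}
    (hJ : ContDiffOn ℝ ∞ J M) (hJ₀ : ∀ q ∈ M, ∀ u, Θ q (J q u) = J₀ (Θ q u))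
    (hΩ : ∀ q ∈ M, ∀ u a, Ω q u (J₀ a) = J₀ (Ω q u a)) (X : E → E) {Y : E → E}
    (hY : DifferentiableAt ℝ Y p) (hp : p ∈ M) :
    nabla g X (fun q => J q (Y q)) p = J p (nabla g X Y p) := by
  have hJp : DifferentiableAt ℝ J p :=
    (hJ.contDiffAt (H.isOpen.mem_nhds hp)).differentiableAt (by simp)
  have hΘY : DifferentiableAt ℝ (fun q => Θ q (Y q)) p :=
    (H.differentiableAt_frame hp).clm_apply hY
  have h1 : (fun q => Θ q (J q (Y q))) =ᶠ[nhds p] fun q => J₀ (Θ q (Y q)) := by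
    filter_upwards [H.isOpen.mem_nhds hp] with q hq using hJ₀ q hq _
  have h2 : HasFDerivAt (fun q => J₀ (Θ q (Y q))) _ p := J₀.hasFDerivAt.comp p hΘY.hasFDerivAt
  apply (H.bijective p hp).1
  rw [H.frame_nabla hp X (hJp.clm_apply hY), h1.fderiv_eq, h2.fderiv, hJ₀ p hp, hJ₀ p hp,
    H.frame_nabla hp X hY, hΩ p hp]
  simp

end IsMovingFrameOn

end MovingFrame

/-! ### Curvature-type operators of a Hermitian form -/

section HermitianForm

variable {E F : Type*} [NormedAddCommGroup E] [NormedSpace ℝ E] [NormedAddCommGroup F]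
  [NormedSpace ℝ F]

/-- The operator `R^H(a,b)c` of a Hermitian form `β` and a complex structure `J` on a fixed vector
space; `curvH` is its value on the tangent spaces. -/
noncomputable def holCurv (J : F →L[ℝ] F) (β : F →L[ℝ] F →L[ℝ] ℝ) (a b c : F) : F :=
  β b c • a - β a c • b + β (J b) c • J a - β (J a) c • J b - (2 * β (J a) b) • J c

/-- `β` is symmetric and `J`-invariant, where `J² = -1`. -/
structure IsHermitianForm (J : F →L[ℝ] F) (β : F →L[ℝ] F →L[ℝ] ℝ) : Prop where
  symm : ∀ a b, β a b = β b a
  sq_eq_neg : ∀ a, J (J a) = -a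
  skew : ∀ a b, β a (J b) = -β (J a) b

/-- An endomorphism in the unitary Lie algebra of `(J, β)`: it is skew and commutes with `J`. -/
structure IsSkewHermitian (J : F →L[ℝ] F) (β : F →L[ℝ] F →L[ℝ] ℝ) (D : F → F) : Prop where
  skew : ∀ a b, β a (D b) = -β (D a) b
  comm : ∀ a, J (D a) = D (J a)

variable {J : F →L[ℝ] F} {β : F →L[ℝ] F →L[ℝ] ℝ} {D : F → F}

theorem IsHermitianForm.isSkewHermitian_holCurv (H : IsHermitianForm J β) (a b : F) :
    IsSkewHermitian J β (holCurv J β a b) where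
  skew c d := by
    simp only [holCurv, map_add, map_sub, map_smul, add_apply, sub_apply, smul_apply, smul_eq_mul]
    rw [H.skew c d, H.symm c a, H.symm c b, H.symm c (J a), H.symm c (J b)]
    ring
  comm c := by
    simp only [holCurv, map_add, map_sub, map_smul, H.skew, H.sq_eq_neg, map_neg, neg_apply]
    module

/-- The unitary Lie algebra annihilates the curvature-type tensor `β(R^H(a,b)c, d)`, since the
latter is a polynomial in `β` and `J`. -/
theorem IsSkewHermitian.holCurv_derivation (HD : IsSkewHermitian J β D) (a b c d : F) :
    β (holCurv J β (D a) b c) d + β (holCurv J β a (D b) c) d + β (holCurv J β a b (D c)) d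
      + β (holCurv J β a b c) (D d) = 0 := by
  simp only [holCurv, map_add, map_sub, map_smul, add_apply, sub_apply, smul_apply, smul_eq_mul,
    HD.skew, HD.comm]
  ring

theorem IsSkewHermitian.add {D' : F → F} (HD : IsSkewHermitian J β D)
    (HD' : IsSkewHermitian J β D') : IsSkewHermitian J β (fun a => D a + D' a) where
  skew a b := by simp only [map_add, HD.skew, HD'.skew, add_apply]; ring
  comm a := by simp only [map_add, HD.comm, HD'.comm]

theorem IsSkewHermitian.smul (r : ℝ) (HD : IsSkewHermitian J β D) :
    IsSkewHermitian J β (fun a => r • D a) where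
  skew a b := by simp only [map_smul, HD.skew, smul_apply, smul_eq_mul]; ring
  comm a := by simp only [map_smul, HD.comm]

end HermitianForm

/-! ### The model space and its splitting -/

section Model

variable {m : ℕ}

/-- The Euclidean inner product of the model space. -/
noncomputable def stdForm (m : ℕ) : Space m →L[ℝ] Space m →L[ℝ] ℝ :=
  (LinearMap.mk₂ ℝ (fun a b : Space m =>
    a.1 ⬝ᵥ b.1 + a.2.1 ⬝ᵥ b.2.1 + a.2.2.1 * b.2.2.1 + a.2.2.2 * b.2.2.2)
    (fun a a' b => by simp only [Prod.fst_add, Prod.snd_add, add_dotProduct]; ring)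
    (fun c a b => by
      simp only [Prod.smul_fst, Prod.smul_snd, smul_dotProduct, smul_eq_mul]; ring)
    (fun a b b' => by simp only [Prod.fst_add, Prod.snd_add, dotProduct_add]; ring)
    (fun c a b => by
      simp only [Prod.smul_fst, Prod.smul_snd, dotProduct_smul, smul_eq_mul]; ring)
    ).toContinuousBilinearMap

theorem stdForm_apply (a b : Space m) : stdForm m a b =
    a.1 ⬝ᵥ b.1 + a.2.1 ⬝ᵥ b.2.1 + a.2.2.1 * b.2.2.1 + a.2.2.2 * b.2.2.2 := rfl

/-- The complex structure of the model space, in the pairs `(x^α, y^α)` and `(z, t)`. -/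
noncomputable def stdComplex (m : ℕ) : Space m →L[ℝ] Space m :=
  LinearMap.toContinuousLinearMap
    { toFun := fun a => (-a.2.1, a.1, -a.2.2.2, a.2.2.1)
      map_add' := fun a b => by ext <;> simp <;> ring
      map_smul' := fun c a => by ext <;> simp }

theorem stdComplex_apply (a : Space m) :
    stdComplex m a = (-a.2.1, a.1, -a.2.2.2, a.2.2.1) := rfl

/-- The projection onto the first `2m` coordinates. -/
noncomputable def horProj (m : ℕ) : Space m →L[ℝ] Space m :=
  LinearMap.toContinuousLinearMap
    { toFun := fun a => (a.1, a.2.1, 0, 0)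
      map_add' := fun a b => by ext <;> simp
      map_smul' := fun c a => by ext <;> simp }

theorem horProj_apply (a : Space m) : horProj m a = (a.1, a.2.1, 0, 0) := rfl

/-- The projection onto the last two coordinates. -/
noncomputable def verProj (m : ℕ) : Space m →L[ℝ] Space m :=
  LinearMap.toContinuousLinearMap
    { toFun := fun a => (0, 0, a.2.2.1, a.2.2.2)
      map_add' := fun a b => by ext <;> simp
      map_smul' := fun c a => by ext <;> simp }

theorem verProj_apply (a : Space m) : verProj m a = (0, 0, a.2.2.1, a.2.2.2) := rfl

theorem stdForm_self_pos (a : Space m) (ha : a ≠ 0) : 0 < stdForm m a a := by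
  have h1 : 0 ≤ a.1 ⬝ᵥ a.1 := Finset.sum_nonneg fun i _ => mul_self_nonneg _
  have h2 : 0 ≤ a.2.1 ⬝ᵥ a.2.1 := Finset.sum_nonneg fun i _ => mul_self_nonneg _
  have h3 := mul_self_nonneg a.2.2.1
  have h4 := mul_self_nonneg a.2.2.2
  rw [stdForm_apply]
  refine lt_of_le_of_ne (by linarith) fun h => ha ?_
  refine Prod.ext (dotProduct_self_eq_zero.1 (by linarith)) (Prod.ext
    (dotProduct_self_eq_zero.1 (by linarith)) (Prod.ext (mul_self_eq_zero.1 (by linarith))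
    (mul_self_eq_zero.1 (by linarith))))

theorem stdForm_nondegenerate (a : Space m) (ha : ∀ b, stdForm m a b = 0) : a = 0 := by
  by_contra h
  exact (stdForm_self_pos a h).ne' (ha a)

theorem stdForm_comm (a b : Space m) : stdForm m a b = stdForm m b a := by
  simp only [stdForm_apply, dotProduct_comm a.1, dotProduct_comm a.2.1]; ring

theorem isHermitianForm_std : IsHermitianForm (stdComplex m) (stdForm m) where
  symm := stdForm_comm
  sq_eq_neg a := by ext <;> simp [stdComplex_apply]
  skew a b := by simp [stdForm_apply, stdComplex_apply]; ring

theorem horProj_stdComplex (a : Space m) :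
    horProj m (stdComplex m a) = stdComplex m (horProj m a) := by
  ext <;> simp [stdComplex_apply, horProj_apply]

theorem verProj_stdComplex (a : Space m) :
    verProj m (stdComplex m a) = stdComplex m (verProj m a) := by
  ext <;> simp [stdComplex_apply, verProj_apply]

theorem stdForm_horProj (a b : Space m) :
    stdForm m a (horProj m b) = stdForm m (horProj m a) b := by
  simp [stdForm_apply, horProj_apply]

theorem stdForm_verProj (a b : Space m) :
    stdForm m a (verProj m b) = stdForm m (verProj m a) b := by
  simp [stdForm_apply, verProj_apply]

theorem horProj_horProj (a : Space m) : horProj m (horProj m a) = horProj m a := rfl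

theorem verProj_verProj (a : Space m) : verProj m (verProj m a) = verProj m a := rfl

theorem horProj_verProj (a : Space m) : horProj m (verProj m a) = 0 := rfl

theorem verProj_horProj (a : Space m) : verProj m (horProj m a) = 0 := rfl

/-- The operators `R^H` of the two summands of the splitting, with weights `μ` and `ν`. -/
noncomputable def splitCurv (m : ℕ) (μ ν : ℝ) (a b c : Space m) : Space m :=
  μ • holCurv (stdComplex m) (stdForm m) (horProj m a) (horProj m b) (horProj m c)
    + ν • holCurv (stdComplex m) (stdForm m) (verProj m a) (verProj m b) (verProj m c)

/-- The curvature operator of the metrics under study, in an orthonormal frame. -/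
noncomputable def modelCurv (m : ℕ) (f μ ν : ℝ) (a b c : Space m) : Space m :=
  f • holCurv (stdComplex m) (stdForm m) a b c + splitCurv m μ ν a b c

/-- The `(0,4)`-tensor of `modelCurv`. -/
noncomputable def modelRiemann (m : ℕ) (f μ ν : ℝ) (Y : Fin 4 → Space m) : ℝ :=
  stdForm m (modelCurv m f μ ν (Y 0) (Y 1) (Y 2)) (Y 3)

theorem horProj_splitCurv (μ ν : ℝ) (a b c : Space m) :
    horProj m (splitCurv m μ ν a b c) = splitCurv m μ ν a b (horProj m c) := by
  simp only [splitCurv, holCurv, map_add, map_sub, map_smul, horProj_stdComplex, horProj_horProj,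
    horProj_verProj, verProj_horProj, map_zero]
  module

theorem verProj_splitCurv (μ ν : ℝ) (a b c : Space m) :
    verProj m (splitCurv m μ ν a b c) = splitCurv m μ ν a b (verProj m c) := by
  simp only [splitCurv, holCurv, map_add, map_sub, map_smul, verProj_stdComplex, verProj_verProj,
    horProj_verProj, verProj_horProj, map_zero]
  module

theorem horProj_holCurv (a b c : Space m) :
    horProj m (holCurv (stdComplex m) (stdForm m) (horProj m a) (horProj m b) (horProj m c)) =
      holCurv (stdComplex m) (stdForm m) (horProj m a) (horProj m b) (horProj m c) := by
  simp only [holCurv, map_add, map_sub, map_smul, horProj_stdComplex, horProj_horProj]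

theorem verProj_holCurv (a b c : Space m) :
    verProj m (holCurv (stdComplex m) (stdForm m) (verProj m a) (verProj m b) (verProj m c)) =
      holCurv (stdComplex m) (stdForm m) (verProj m a) (verProj m b) (verProj m c) := by
  simp only [holCurv, map_add, map_sub, map_smul, verProj_stdComplex, verProj_verProj]

theorem isSkewHermitian_splitCurv (μ ν : ℝ) (a b : Space m) :
    IsSkewHermitian (stdComplex m) (stdForm m) (splitCurv m μ ν a b) := by
  have hH := isHermitianForm_std.isSkewHermitian_holCurv (horProj m a) (horProj m b)
  have hV := isHermitianForm_std.isSkewHermitian_holCurv (verProj m a) (verProj m b)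
  refine IsSkewHermitian.add (.smul μ ⟨fun c d => ?_, fun c => ?_⟩)
    (.smul ν ⟨fun c d => ?_, fun c => ?_⟩)
  · rw [← horProj_holCurv a b d, ← horProj_holCurv a b c, stdForm_horProj, hH.skew,
      ← stdForm_horProj]
  · rw [hH.comm, horProj_stdComplex]
  · rw [← verProj_holCurv a b d, ← verProj_holCurv a b c, stdForm_verProj, hV.skew,
      ← stdForm_verProj]
  · rw [hV.comm, verProj_stdComplex]

/-- The projections can be moved to the last argument, which displays the three summands as
pullbacks of one tensor. -/
theorem modelRiemann_eq (f μ ν : ℝ) (Y : Fin 4 → Space m) :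
    modelRiemann m f μ ν Y =
      f * stdForm m (holCurv (stdComplex m) (stdForm m) (Y 0) (Y 1) (Y 2)) (Y 3)
      + μ * stdForm m (holCurv (stdComplex m) (stdForm m) (horProj m (Y 0)) (horProj m (Y 1))
          (horProj m (Y 2))) (horProj m (Y 3))
      + ν * stdForm m (holCurv (stdComplex m) (stdForm m) (verProj m (Y 0)) (verProj m (Y 1))
          (verProj m (Y 2))) (verProj m (Y 3)) := by
  simp only [modelRiemann, modelCurv, splitCurv, map_add, map_smul, add_apply, smul_apply,
    smul_eq_mul, stdForm_horProj, stdForm_verProj, horProj_holCurv, verProj_holCurv]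
  ring

theorem derivationAct_four {E : Type*} (A : E → E)
    (T : (Fin 4 → E) → ℝ) (a b c d : E) :
    derivationAct A T ![a, b, c, d] =
      -(T ![A a, b, c, d] + T ![a, A b, c, d] + T ![a, b, A c, d] + T ![a, b, c, A d]) := by
  simp only [derivationAct, Fin.sum_univ_four]
  congr 4 <;> congr 1 <;> ext i <;> fin_cases i <;> rfl

/-- The operators `splitCurv` preserve `β`, `J` and the splitting, hence annihilate every tensor
that is a polynomial in these, such as the curvature tensor. -/
theorem derivationAct_splitCurv_modelRiemann (f μ ν : ℝ) (a b : Space m) (Y : Fin 4 → Space m) :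
    derivationAct (splitCurv m μ ν a b) (modelRiemann m f μ ν) Y = 0 := by
  have hD := isSkewHermitian_splitCurv μ ν a b
  have hY : Y = ![Y 0, Y 1, Y 2, Y 3] := by ext i <;> fin_cases i <;> rfl
  have h1 := hD.holCurv_derivation (Y 0) (Y 1) (Y 2) (Y 3)
  have h2 := hD.holCurv_derivation (horProj m (Y 0)) (horProj m (Y 1)) (horProj m (Y 2))
    (horProj m (Y 3))
  have h3 := hD.holCurv_derivation (verProj m (Y 0)) (verProj m (Y 1)) (verProj m (Y 2))
    (verProj m (Y 3))
  simp only [← horProj_splitCurv] at h2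
  simp only [← verProj_splitCurv] at h3
  rw [hY, derivationAct_four]
  simp only [modelRiemann_eq, Matrix.cons_val]
  linear_combination -f * h1 - μ * h2 - ν * h3

/-- A tensor which is a combination of the metrics of the two summands of the splitting. -/
noncomputable def splitForm (m : ℕ) (σ τ : ℝ) (a b : Space m) : ℝ :=
  σ * stdForm m (horProj m a) b + τ * stdForm m (verProj m a) b

theorem splitForm_splitCurv (σ τ μ ν : ℝ) (a b c d : Space m) :
    splitForm m σ τ (splitCurv m μ ν a b c) d + splitForm m σ τ c (splitCurv m μ ν a b d) = 0 := by
  have hD := isSkewHermitian_splitCurv μ ν a b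
  simp only [splitForm, hD.skew, horProj_splitCurv, verProj_splitCurv]
  ring

/-! ### Traces on the model space -/

theorem finrank_space : Module.finrank ℝ (Space m) = 2 * m + 2 := by
  simp; ring

theorem trace_horProj : LinearMap.trace ℝ (Space m) (horProj m) = 2 * m := by
  have h : (horProj m : Space m →ₗ[ℝ] Space m) =
      LinearMap.prodMap LinearMap.id (LinearMap.prodMap LinearMap.id 0) := by
    ext <;> simp [horProj_apply]
  rw [h, LinearMap.trace_prodMap', LinearMap.trace_prodMap', LinearMap.trace_id]
  simp
  ring

theorem trace_verProj : LinearMap.trace ℝ (Space m) (verProj m) = 2 := by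
  have h : (verProj m : Space m →ₗ[ℝ] Space m) =
      LinearMap.id - (horProj m : Space m →ₗ[ℝ] Space m) := by
    ext <;> simp [horProj_apply, verProj_apply]
  rw [h, map_sub, trace_horProj, LinearMap.trace_id, finrank_space]
  push_cast
  ring

/-- The complex conjugation `(x, y, z, t) ↦ (x, -y, z, -t)`, as an involution. -/
noncomputable def conjugation (m : ℕ) : Space m ≃ₗ[ℝ] Space m :=
  (LinearEquiv.refl ℝ _).prodCongr ((LinearEquiv.neg ℝ).prodCongr
    ((LinearEquiv.refl ℝ _).prodCongr (LinearEquiv.neg ℝ)))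

/-- An operator that anticommutes with the conjugation is conjugate to its negative, hence
traceless. -/
theorem trace_eq_zero_of_conj (A : Space m →ₗ[ℝ] Space m)
    (hA : ∀ a, conjugation m (A a) = -A (conjugation m a)) : LinearMap.trace ℝ (Space m) A = 0 := by
  have h : (conjugation m).conj A = -A := by
    refine LinearMap.ext fun a => ?_
    obtain ⟨b, rfl⟩ := (conjugation m).surjective a
    rw [LinearEquiv.conj_apply_apply, LinearEquiv.symm_apply_apply, hA]
    rfl
  have h2 := LinearMap.trace_conj' A (conjugation m)
  rw [h, map_neg] at h2
  linarith

theorem trace_stdComplex : LinearMap.trace ℝ (Space m) (stdComplex m) = 0 :=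
  trace_eq_zero_of_conj _ fun a => by ext <;> simp [conjugation, stdComplex_apply]

theorem trace_stdComplex_horProj :
    LinearMap.trace ℝ (Space m) ((stdComplex m).comp (horProj m)) = 0 :=
  trace_eq_zero_of_conj _ fun a => by
    ext <;> simp [conjugation, stdComplex_apply, horProj_apply]

theorem trace_stdComplex_verProj :
    LinearMap.trace ℝ (Space m) ((stdComplex m).comp (verProj m)) = 0 :=
  trace_eq_zero_of_conj _ fun a => by
    ext <;> simp [conjugation, stdComplex_apply, verProj_apply]

/-- The endomorphism `x ↦ R^H(Px, Pa)Pb`. -/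
noncomputable def holCurvEndo (P : Space m →L[ℝ] Space m) (a b : Space m) :
    Space m →ₗ[ℝ] Space m where
  toFun x := holCurv (stdComplex m) (stdForm m) (P x) (P a) (P b)
  map_add' x y := by simp only [holCurv, map_add, add_apply]; module
  map_smul' c x := by
    simp only [holCurv, map_smul, smul_apply, smul_eq_mul, RingHom.id_apply]; module

/-- The Ricci contraction of `R^H` on the image of a `J`-linear orthogonal projection. -/
theorem trace_holCurvEndo (P : Space m →L[ℝ] Space m) (hP : ∀ a, P (P a) = P a)
    (hPJ : ∀ a, P (stdComplex m a) = stdComplex m (P a))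
    (hPs : ∀ a b, stdForm m a (P b) = stdForm m (P a) b)
    (htr : LinearMap.trace ℝ (Space m) ((stdComplex m).comp P) = 0) (a b : Space m) :
    LinearMap.trace ℝ (Space m) (holCurvEndo P a b) =
      (LinearMap.trace ℝ (Space m) P + 2) * stdForm m (P a) b := by
  have H := isHermitianForm_std (m := m)
  have h : holCurvEndo P a b = stdForm m (P a) b • (P : Space m →ₗ[ℝ] Space m)
      - ((stdForm m (P b) : Space m →L[ℝ] ℝ) : Space m →ₗ[ℝ] ℝ).smulRight (P a)
      + stdForm m (stdComplex m (P a)) b • (((stdComplex m).comp P : Space m →L[ℝ] Space m) :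
        Space m →ₗ[ℝ] Space m)
      + ((stdForm m (stdComplex m (P b)) : Space m →L[ℝ] ℝ) : Space m →ₗ[ℝ] ℝ).smulRight
        (stdComplex m (P a))
      + (2 : ℝ) • ((stdForm m (stdComplex m (P a)) : Space m →L[ℝ] ℝ) :
        Space m →ₗ[ℝ] ℝ).smulRight (stdComplex m (P b)) := by
    refine LinearMap.ext fun x => ?_
    have e1 : stdForm m (P a) (P b) = stdForm m (P a) b := by rw [hPs, hP]
    have e2 : stdForm m (P x) (P b) = stdForm m (P b) x := by
      rw [← hPs, hP, H.symm]
    have e3 : stdForm m (stdComplex m (P a)) (P b) = stdForm m (stdComplex m (P a)) b := by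
      rw [hPs, hPJ, hP]
    have e4 (c : Space m) : stdForm m (stdComplex m (P x)) (P c) =
        -stdForm m (stdComplex m (P c)) x := by
      rw [H.symm, H.skew, hPs, hPJ, hP]
    simp only [holCurvEndo, holCurv, LinearMap.coe_mk, AddHom.coe_mk, e1, e2, e3, e4,
      LinearMap.add_apply, LinearMap.sub_apply, LinearMap.smul_apply, LinearMap.smulRight_apply,
      ContinuousLinearMap.coe_coe, ContinuousLinearMap.comp_apply]
    module
  rw [h]
  have e1 : stdForm m (P b) (P a) = stdForm m (P a) b := by rw [← hPs, hP, H.symm]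
  have e2 : stdForm m (stdComplex m (P a)) (stdComplex m (P b)) = stdForm m (P a) b := by
    rw [H.skew, H.sq_eq_neg, map_neg, neg_apply, neg_neg, hPs, hP]
  simp only [map_add, map_sub, map_smul, LinearMap.trace_smulRight, htr, smul_eq_mul,
    ContinuousLinearMap.coe_coe, e1, e2, H.symm (stdComplex m (P b))]
  ring

/-- The Ricci tensor of the model curvature. -/
theorem trace_modelCurv (f μ ν : ℝ) (A : Space m →ₗ[ℝ] Space m) (a b : Space m)
    (hA : ∀ x, A x = modelCurv m f μ ν x a b) :
    LinearMap.trace ℝ (Space m) A =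
      splitForm m (2 * (m + 2) * f + 2 * (m + 1) * μ) (2 * (m + 2) * f + 4 * ν) a b := by
  have h : A = f • holCurvEndo (.id ℝ _) a b + μ • holCurvEndo (horProj m) a b
      + ν • holCurvEndo (verProj m) a b := by
    refine LinearMap.ext fun x => ?_
    rw [hA, modelCurv, splitCurv, add_assoc]
    rfl
  have h1 := trace_holCurvEndo (.id ℝ (Space m)) (fun _ => rfl) (fun _ => rfl) (fun _ _ => rfl)
    trace_stdComplex a b
  have h2 := trace_holCurvEndo (horProj m) horProj_horProj horProj_stdComplex stdForm_horProj
    trace_stdComplex_horProj a b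
  have h3 := trace_holCurvEndo (verProj m) verProj_verProj verProj_stdComplex stdForm_verProj
    trace_stdComplex_verProj a b
  have h4 : LinearMap.trace ℝ (Space m) (ContinuousLinearMap.id ℝ (Space m)) = 2 * m + 2 := by
    rw [ContinuousLinearMap.coe_id, LinearMap.trace_id, finrank_space]
    push_cast
    ring
  have h5 : stdForm m (ContinuousLinearMap.id ℝ (Space m) a) b =
      stdForm m (horProj m a) b + stdForm m (verProj m a) b := by
    rw [← add_apply, ← map_add]
    congr 2
    ext <;> simp [horProj_apply, verProj_apply]
  rw [h, map_add, map_add, map_smul, map_smul, map_smul, h1, h2, h3, h4, h5, trace_horProj,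
    trace_verProj]
  simp only [splitForm, smul_eq_mul]
  ring

end Model

/-! ### The connection form of the example -/

section ConnectionForm

variable {m : ℕ}

/-- The part of the connection form with coefficient `h`:
`a, b ↦ b_t a' - ⟨a', b'⟩ e_t - b_z Ja' + ⟨Ja', b'⟩ e_z - a_z Jb`, where `a'` and `b'` are the
projections onto the first `2m` coordinates. -/
noncomputable def connOne (m : ℕ) : Space m →L[ℝ] Space m →L[ℝ] Space m :=
  (LinearMap.mk₂ ℝ (fun a b : Space m =>
    ((b.2.2.2 • a.1 + b.2.2.1 • a.2.1 + a.2.2.1 • b.2.1,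
      b.2.2.2 • a.2.1 - b.2.2.1 • a.1 - a.2.2.1 • b.1,
      a.1 ⬝ᵥ b.2.1 - a.2.1 ⬝ᵥ b.1 + a.2.2.1 * b.2.2.2,
      -(a.1 ⬝ᵥ b.1) - a.2.1 ⬝ᵥ b.2.1 - a.2.2.1 * b.2.2.1) : Space m))
    (fun a a' b => by ext <;> simp [add_dotProduct] <;> ring)
    (fun c a b => by ext <;> simp [smul_dotProduct] <;> ring)
    (fun a b b' => by ext <;> simp [dotProduct_add] <;> ring)
    (fun c a b => by ext <;> simp [dotProduct_smul] <;> ring)).toContinuousBilinearMap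

theorem connOne_apply (a b : Space m) : connOne m a b =
    (b.2.2.2 • a.1 + b.2.2.1 • a.2.1 + a.2.2.1 • b.2.1,
      b.2.2.2 • a.2.1 - b.2.2.1 • a.1 - a.2.2.1 • b.1,
      a.1 ⬝ᵥ b.2.1 - a.2.1 ⬝ᵥ b.1 + a.2.2.1 * b.2.2.2,
      -(a.1 ⬝ᵥ b.1) - a.2.1 ⬝ᵥ b.2.1 - a.2.2.1 * b.2.2.1) := rfl

/-- The part of the connection form with coefficient `-(h + t h')`: `a, b ↦ a_z J b''`, where
`b''` is the projection onto the last two coordinates. -/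
noncomputable def connTwo (m : ℕ) : Space m →L[ℝ] Space m →L[ℝ] Space m :=
  (LinearMap.mk₂ ℝ (fun a b : Space m =>
    ((0, 0, -(a.2.2.1 * b.2.2.2), a.2.2.1 * b.2.2.1) : Space m))
    (fun a a' b => by ext <;> simp <;> ring)
    (fun c a b => by ext <;> simp <;> ring)
    (fun a b b' => by ext <;> simp <;> ring)
    (fun c a b => by ext <;> simp <;> ring)).toContinuousBilinearMap

theorem connTwo_apply (a b : Space m) : connTwo m a b =
    (0, 0, -(a.2.2.1 * b.2.2.2), a.2.2.1 * b.2.2.1) := rfl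

theorem connOne_skew (a b c : Space m) :
    stdForm m (connOne m a b) c = -stdForm m b (connOne m a c) := by
  simp [connOne_apply, stdForm_apply, dotProduct_comm _ a.1, dotProduct_comm _ a.2.1]
  ring

theorem connTwo_skew (a b c : Space m) :
    stdForm m (connTwo m a b) c = -stdForm m b (connTwo m a c) := by
  simp [connTwo_apply, stdForm_apply]
  ring

theorem connOne_stdComplex (a b : Space m) :
    connOne m a (stdComplex m b) = stdComplex m (connOne m a b) := by
  ext <;> simp [connOne_apply, stdComplex_apply] <;> ring

theorem connTwo_stdComplex (a b : Space m) :
    connTwo m a (stdComplex m b) = stdComplex m (connTwo m a b) := by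
  ext <;> simp [connTwo_apply, stdComplex_apply]

/-- The curvature of the connection form `W = h • connOne - (h + t h₁) • connTwo`, computed by the
second structure equation. Here `h₁` and `h₂` stand for `h'` and `h''`, the covectors `dt` and
`dΘ` have been expressed in the frame, and the result is a combination of the operators `R^H` of
the model space and of its two summands. -/
theorem connection_curvature (t h h₁ h₂ : ℝ) (W : Space m → Space m → Space m)
    (hW : ∀ a b, W a b = h • connOne m a b - (h + t * h₁) • connTwo m a b) (a b c : Space m) :
    (t * h * a.2.2.2) • (h₁ • connOne m b c - (2 * h₁ + t * h₂) • connTwo m b c)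
      - (t * h * b.2.2.2) • (h₁ • connOne m a c - (2 * h₁ + t * h₂) • connTwo m a c)
      + W (W b a - W a b) c + W a (W b c) - W b (W a c) =
    modelCurv m (-(h * (h + t * h₁))) (t * h * h₁)
      (-(3 * t * h * h₁ + t ^ 2 * (h * h₂ + h₁ ^ 2)) / 4) a b c := by
  obtain ⟨a1, a2, az, at'⟩ := a
  obtain ⟨b1, b2, bz, bt⟩ := b
  obtain ⟨c1, c2, cz, ct⟩ := c
  -- Both sides are polynomials in the scalars and the inner products of the horizontal parts, whose
  -- order is normalized first.
  have e1 := dotProduct_comm b1 a1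
  have e2 := dotProduct_comm b2 a1
  have e3 := dotProduct_comm b1 a2
  have e4 := dotProduct_comm b2 a2
  simp only [hW]
  ext <;> simp [connOne_apply, connTwo_apply, modelCurv, splitCurv, holCurv, stdForm_apply,
    stdComplex_apply, horProj_apply, verProj_apply, add_dotProduct, sub_dotProduct,
    smul_dotProduct, neg_dotProduct, dotProduct_add, dotProduct_sub, dotProduct_smul,
    e1, e2, e3, e4] <;> ring

end ConnectionForm

/-! ### The orthonormal frame of the example -/

section Frame

variable {m : ℕ} {N : Set ((Fin m → ℝ) × (Fin m → ℝ) × ℝ)} {A B : ℝ} {h : ℝ → ℝ} {p : Space m}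

theorem Admissible.contDiffAt (H : Admissible h A B) {t : ℝ} (ht : t ∈ Ioo A B) :
    ContDiffAt ℝ ∞ h t :=
  H.1.contDiffAt (isOpen_Ioo.mem_nhds ht)

theorem Admissible.hasDerivAt (H : Admissible h A B) {t : ℝ} (ht : t ∈ Ioo A B) :
    HasDerivAt h (deriv h t) t :=
  ((H.contDiffAt ht).differentiableAt (by simp)).hasDerivAt

theorem Admissible.hasDerivAt_deriv (H : Admissible h A B) {t : ℝ} (ht : t ∈ Ioo A B) :
    HasDerivAt (deriv h) (deriv (deriv h) t) t :=
  (((H.1.deriv_of_isOpen (m := ∞) isOpen_Ioo (by simp)).contDiffAt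
    (isOpen_Ioo.mem_nhds ht)).differentiableAt (by simp)).hasDerivAt

theorem isOpen_domain (hN : IsOpen N) : IsOpen (domain N A B) :=
  (hN.preimage (by fun_prop : Continuous fun p : Space m => (p.1, p.2.1, p.2.2.1))).inter
    (isOpen_Ioo.preimage (by fun_prop : Continuous fun p : Space m => tCoord p))

/-- The bilinear map `u, v ↦ -2 (∑ x^λ(u) y^λ(v)) e_z`. -/
noncomputable def contactMap (m : ℕ) : Space m →L[ℝ] Space m →L[ℝ] Space m :=
  (LinearMap.mk₂ ℝ (fun a b : Space m => ((0, 0, -2 * (a.1 ⬝ᵥ b.2.1), 0) : Space m))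
    (fun a a' b => by ext <;> simp [add_dotProduct]; ring)
    (fun c a b => by ext <;> simp [smul_dotProduct]; ring)
    (fun a b b' => by ext <;> simp [dotProduct_add]; ring)
    (fun c a b => by ext <;> simp [dotProduct_smul]; ring)).toContinuousBilinearMap

theorem contactMap_apply (a b : Space m) :
    contactMap m a b = (0, 0, -2 * (a.1 ⬝ᵥ b.2.1), 0) := rfl

/-- The coframe `(θ^i)` at a point, as one linear map into the model space. -/
noncomputable def frameMap (h : ℝ → ℝ) (p : Space m) : Space m →L[ℝ] Space m :=
  tCoord p • horProj m
    + (tCoord p ^ 2 * h (tCoord p)) • (dz.smulRight (0, 0, 1, 0) + contactMap m p)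
    + (1 / (tCoord p * h (tCoord p))) • dt.smulRight (0, 0, 0, 1)

theorem frameMap_apply (h : ℝ → ℝ) (p a : Space m) : frameMap h p a =
    (tCoord p • a.1, tCoord p • a.2.1,
      tCoord p ^ 2 * h (tCoord p) * (a.2.2.1 - 2 * (p.1 ⬝ᵥ a.2.1)),
      1 / (tCoord p * h (tCoord p)) * a.2.2.2) := by
  ext <;> simp [frameMap, horProj_apply, contactMap_apply, dz, dt]
  ring

theorem frameMap_eq_coframe (h : ℝ → ℝ) (p a : Space m) : frameMap h p a =
    (fun α => coframe h (ix α) p a, fun α => coframe h (iy α) p a, coframe h iz p a,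
      coframe h it p a) := by
  rw [frameMap_apply]
  ext <;> simp [coframe, dx, dy, dz, dt, dotProduct]
  ring

theorem hasFDerivAt_tCoord_comp {φ : ℝ → ℝ} {φ' : ℝ} (hφ : HasDerivAt φ φ' (tCoord p)) :
    HasFDerivAt (fun q : Space m => φ (tCoord q)) (φ' • (dt : Space m →L[ℝ] ℝ)) p :=
  hφ.comp_hasFDerivAt p (dt : Space m →L[ℝ] ℝ).hasFDerivAt

theorem contDiffAt_tCoord : ContDiffAt ℝ ∞ (fun q : Space m => tCoord q) p :=
  (dt : Space m →L[ℝ] ℝ).contDiff.contDiffAt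

theorem contDiffAt_comp_tCoord (H : Admissible h A B) (hp : tCoord p ∈ Ioo A B) :
    ContDiffAt ℝ ∞ (fun q : Space m => h (tCoord q)) p :=
  (H.contDiffAt hp).comp p contDiffAt_tCoord

theorem contDiffAt_frameMap (hA : 0 ≤ A) (H : Admissible h A B) (hp : tCoord p ∈ Ioo A B) :
    ContDiffAt ℝ ∞ (frameMap (m := m) h) p := by
  have ht := contDiffAt_tCoord (p := p)
  have hh := contDiffAt_comp_tCoord H hp
  have h0 : tCoord p * h (tCoord p) ≠ 0 :=
    mul_ne_zero (hA.trans_lt hp.1).ne' (H.2 _ hp)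
  exact ((ht.smul contDiffAt_const).add (((ht.pow 2).mul hh).smul
    (contDiffAt_const.add (contactMap m).contDiff.contDiffAt))).add
    ((contDiffAt_const.div (ht.mul hh) h0).smul contDiffAt_const)

theorem fderiv_frameMap (hA : 0 ≤ A) (H : Admissible h A B) (hp : tCoord p ∈ Ioo A B)
    (u v : Space m) : fderiv ℝ (frameMap h) p u v =
      (u.2.2.2 • v.1, u.2.2.2 • v.2.1,
        (2 * tCoord p * h (tCoord p) + tCoord p ^ 2 * deriv h (tCoord p)) * u.2.2.2 *
          (v.2.2.1 - 2 * (p.1 ⬝ᵥ v.2.1)) -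
          2 * (tCoord p ^ 2 * h (tCoord p)) * (u.1 ⬝ᵥ v.2.1),
        -(h (tCoord p) + tCoord p * deriv h (tCoord p)) / (tCoord p * h (tCoord p)) ^ 2 *
          u.2.2.2 * v.2.2.2) := by
  have h0 : tCoord p * h (tCoord p) ≠ 0 :=
    mul_ne_zero (hA.trans_lt hp.1).ne' (H.2 _ hp)
  have hid := hasDerivAt_id (tCoord p)
  have hh := H.hasDerivAt hp
  have d1 := hasFDerivAt_tCoord_comp hid
  have d2 := hasFDerivAt_tCoord_comp ((hid.pow 2).mul hh)
  have d3 := hasFDerivAt_tCoord_comp ((hasDerivAt_const (tCoord p) (1 : ℝ)).div (hid.mul hh) h0)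
  have d : HasFDerivAt (frameMap (m := m) h) _ p :=
    ((d1.smul (hasFDerivAt_const (horProj m) p)).add (d2.smul
      ((hasFDerivAt_const (dz.smulRight ((0, 0, 1, 0) : Space m)) p).add
        (contactMap m).hasFDerivAt))).add
      (d3.smul (hasFDerivAt_const (dt.smulRight ((0, 0, 0, 1) : Space m)) p))
  rw [d.fderiv]
  ext <;> simp [horProj_apply, contactMap_apply, dz, dt]; ring

theorem frameMap_bijective (hA : 0 ≤ A) (H : Admissible h A B) (hp : tCoord p ∈ Ioo A B) :
    Function.Bijective (frameMap h p) := by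
  have ht : tCoord p ≠ 0 := (hA.trans_lt hp.1).ne'
  have hh : h (tCoord p) ≠ 0 := H.2 _ hp
  have hi : Function.Injective (frameMap h p : Space m →ₗ[ℝ] Space m) := by
    refine (injective_iff_map_eq_zero _).2 fun a ha => ?_
    rw [ContinuousLinearMap.coe_coe, frameMap_apply] at ha
    have e1 : a.1 = 0 := (smul_eq_zero.1 (congrArg Prod.fst ha)).resolve_left ht
    have e2 : a.2.1 = 0 := (smul_eq_zero.1 (congrArg (fun b => b.2.1) ha)).resolve_left ht
    have e3 := congrArg (fun b => b.2.2.1) ha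
    have e4 := congrArg (fun b => b.2.2.2) ha
    simp [e2, ht, hh] at e3
    simp [ht, hh] at e4
    exact Prod.ext e1 (Prod.ext e2 (Prod.ext e3 e4))
  exact ⟨hi, LinearMap.injective_iff_surjective.1 hi⟩

/-- The connection form of the Levi-Civita connection in the orthonormal frame. -/
noncomputable def connForm (h : ℝ → ℝ) (p : Space m) : Space m →L[ℝ] Space m →L[ℝ] Space m :=
  h (tCoord p) • (connOne m).comp (frameMap h p)
    - (h (tCoord p) + tCoord p * deriv h (tCoord p)) • (connTwo m).comp (frameMap h p)

theorem connForm_apply (h : ℝ → ℝ) (p u a : Space m) : connForm h p u a =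
    h (tCoord p) • connOne m (frameMap h p u) a
      - (h (tCoord p) + tCoord p * deriv h (tCoord p)) • connTwo m (frameMap h p u) a := rfl

/-- The derivative of the connection form. It is stated through its values, which are all that
enters the curvature. -/
theorem hasFDerivAt_connForm (hA : 0 ≤ A) (H : Admissible h A B) (hp : tCoord p ∈ Ioo A B) :
    ∃ L : Space m →L[ℝ] Space m →L[ℝ] Space m →L[ℝ] Space m,
      HasFDerivAt (connForm h) L p ∧ ∀ u v c : Space m, L u v c =
      u.2.2.2 • (deriv h (tCoord p) • connOne m (frameMap h p v) c
        - (2 * deriv h (tCoord p) + tCoord p * deriv (deriv h) (tCoord p)) •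
          connTwo m (frameMap h p v) c)
      + (h (tCoord p) • connOne m (fderiv ℝ (frameMap h) p u v) c
        - (h (tCoord p) + tCoord p * deriv h (tCoord p)) •
          connTwo m (fderiv ℝ (frameMap h) p u v) c) := by
  have hid := hasDerivAt_id (tCoord p)
  have hh := H.hasDerivAt hp
  have hh' := H.hasDerivAt_deriv hp
  have dΘ := ((contDiffAt_frameMap (m := m) hA H hp).differentiableAt (by simp)).hasFDerivAt
  have d1 := hasFDerivAt_tCoord_comp hh
  have d2 := hasFDerivAt_tCoord_comp (hh.add (hid.mul hh'))
  have c1 : HasFDerivAt (fun q => (connOne m).comp (frameMap h q)) _ p :=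
    (hasFDerivAt_const (connOne m) p).clm_comp dΘ
  have c2 : HasFDerivAt (fun q => (connTwo m).comp (frameMap h q)) _ p :=
    (hasFDerivAt_const (connTwo m) p).clm_comp dΘ
  have d : HasFDerivAt (connForm (m := m) h) _ p := (d1.smul c1).sub (d2.smul c2)
  refine ⟨_, d, fun u v c => ?_⟩
  simp [dt]
  module

theorem metric_apply (h : ℝ → ℝ) (p u v : Space m) :
    metric h p u v = stdForm m (frameMap h p u) (frameMap h p v) := by
  simp [metric, frameMap_eq_coframe, stdForm_apply, dotProduct, Fintype.sum_sum_type]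
  ring

theorem contDiffAt_coframe (hA : 0 ≤ A) (H : Admissible h A B) (hp : tCoord p ∈ Ioo A B)
    (i : Idx m) : ContDiffAt ℝ ∞ (coframe h i) p := by
  have ht := contDiffAt_tCoord (p := p)
  have hh := contDiffAt_comp_tCoord H hp
  have h0 : tCoord p * h (tCoord p) ≠ 0 :=
    mul_ne_zero (hA.trans_lt hp.1).ne' (H.2 _ hp)
  match i with
  | Sum.inl α => exact ht.smul contDiffAt_const
  | Sum.inr (Sum.inl α) => exact ht.smul contDiffAt_const
  | Sum.inr (Sum.inr 0) =>
    have hs : ContDiffAt ℝ ∞ (fun q : Space m => ∑ l, q.1 l • (dy l : Space m →L[ℝ] ℝ)) p :=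
      ContDiffAt.sum fun l _ => ((dx l).contDiff.contDiffAt).smul contDiffAt_const
    exact ((ht.pow 2).mul hh).smul ((hs.const_smul (-(2 : ℝ))).add contDiffAt_const)
  | Sum.inr (Sum.inr 1) => exact (contDiffAt_const.div (ht.mul hh) h0).smul contDiffAt_const

theorem contDiffAt_frame (hA : 0 ≤ A) (H : Admissible h A B) (hp : tCoord p ∈ Ioo A B)
    (i : Idx m) : ContDiffAt ℝ ∞ (frame h i) p := by
  have ht := contDiffAt_tCoord (p := p)
  have hh := contDiffAt_comp_tCoord H hp
  have ht0 : tCoord p ≠ 0 := (hA.trans_lt hp.1).ne'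
  have hh0 : h (tCoord p) ≠ 0 := H.2 _ hp
  have hinv : ContDiffAt ℝ ∞ (fun q : Space m => 1 / tCoord q) p :=
    contDiffAt_const.div ht ht0
  have hs (α : Fin m) :
      ContDiffAt ℝ ∞ (fun q : Space m => (Pi.single α (1 / tCoord q) : Fin m → ℝ)) p :=
    (ContinuousLinearMap.single ℝ (fun _ : Fin m => ℝ) α).contDiff.contDiffAt.comp p hinv
  match i with
  | Sum.inl α => exact (hs α).prodMk contDiffAt_const
  | Sum.inr (Sum.inl α) =>
    exact contDiffAt_const.prodMk ((hs α).prodMk ((hinv.mul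
      (contDiffAt_const.mul (dx α).contDiff.contDiffAt)).prodMk contDiffAt_const))
  | Sum.inr (Sum.inr 0) =>
    exact contDiffAt_const.prodMk (contDiffAt_const.prodMk
      ((contDiffAt_const.div ((ht.pow 2).mul hh) (mul_ne_zero (pow_ne_zero 2 ht0) hh0)).prodMk
        contDiffAt_const))
  | Sum.inr (Sum.inr 1) =>
    exact contDiffAt_const.prodMk (contDiffAt_const.prodMk
      (contDiffAt_const.prodMk (ht.mul hh)))

theorem contDiffAt_rotatedFrame (hA : 0 ≤ A) (H : Admissible h A B) (hp : tCoord p ∈ Ioo A B)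
    (i : Idx m) : ContDiffAt ℝ ∞ (rotatedFrame h i) p := by
  match i with
  | Sum.inl α => exact contDiffAt_frame hA H hp (iy α)
  | Sum.inr (Sum.inl α) => exact (contDiffAt_frame hA H hp (ix α)).neg
  | Sum.inr (Sum.inr 0) => exact contDiffAt_frame hA H hp it
  | Sum.inr (Sum.inr 1) => exact (contDiffAt_frame hA H hp iz).neg

theorem contDiffAt_metric (hA : 0 ≤ A) (H : Admissible h A B) (hp : tCoord p ∈ Ioo A B) :
    ContDiffAt ℝ ∞ (metric (m := m) h) p :=
  ContDiffAt.sum fun i _ => (contDiffAt_coframe hA H hp i).smulRight (contDiffAt_coframe hA H hp i)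

theorem contDiffAt_complexStr (hA : 0 ≤ A) (H : Admissible h A B) (hp : tCoord p ∈ Ioo A B) :
    ContDiffAt ℝ ∞ (complexStr (m := m) h) p :=
  ContDiffAt.sum fun i _ =>
    (contDiffAt_coframe hA H hp i).smulRight (contDiffAt_rotatedFrame hA H hp i)

theorem coframe_frame (ht : tCoord p ≠ 0) (hh : h (tCoord p) ≠ 0) (i j : Idx m) :
    coframe h i p (frame h j p) = if i = j then 1 else 0 := by
  have e (α : Fin m) : ∑ x, p.1 x * (Pi.single α (tCoord p)⁻¹ : Fin m → ℝ) x
      = p.1 α * (tCoord p)⁻¹ := by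
    rw [Finset.sum_eq_single α] <;> simp +contextual
  match i, j with
  | Sum.inl α, Sum.inl β =>
    by_cases hab : α = β <;> simp [coframe, frame, dx, hab, ht]
  | Sum.inl α, Sum.inr (Sum.inl β) => simp [coframe, frame, dx]
  | Sum.inl α, Sum.inr (Sum.inr 0) => simp [coframe, frame, dx]
  | Sum.inl α, Sum.inr (Sum.inr 1) => simp [coframe, frame, dx]
  | Sum.inr (Sum.inl α), Sum.inl β => simp [coframe, frame, dy]
  | Sum.inr (Sum.inl α), Sum.inr (Sum.inl β) =>
    by_cases hab : α = β <;> simp [coframe, frame, dy, hab, ht]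
  | Sum.inr (Sum.inl α), Sum.inr (Sum.inr 0) => simp [coframe, frame, dy]
  | Sum.inr (Sum.inl α), Sum.inr (Sum.inr 1) => simp [coframe, frame, dy]
  | Sum.inr (Sum.inr 0), Sum.inl β => simp [coframe, frame, dy, dz]
  | Sum.inr (Sum.inr 0), Sum.inr (Sum.inl β) =>
    simp [coframe, frame, dy, dz, e]
    ring
  | Sum.inr (Sum.inr 0), Sum.inr (Sum.inr 0) =>
    simp [coframe, frame, dy, dz]
    field_simp
  | Sum.inr (Sum.inr 0), Sum.inr (Sum.inr 1) => simp [coframe, frame, dy, dz]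
  | Sum.inr (Sum.inr 1), Sum.inl β => simp [coframe, frame, dt]
  | Sum.inr (Sum.inr 1), Sum.inr (Sum.inl β) => simp [coframe, frame, dt]
  | Sum.inr (Sum.inr 1), Sum.inr (Sum.inr 0) => simp [coframe, frame, dt]
  | Sum.inr (Sum.inr 1), Sum.inr (Sum.inr 1) =>
    simp [coframe, frame, dt]
    field_simp

theorem metric_frame (ht : tCoord p ≠ 0) (hh : h (tCoord p) ≠ 0) (i j : Idx m) :
    metric h p (frame h i p) (frame h j p) = if i = j then 1 else 0 := by
  simp [metric, coframe_frame ht hh, -Fintype.sum_sum_type]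

theorem complexStr_frame (ht : tCoord p ≠ 0) (hh : h (tCoord p) ≠ 0) (i : Idx m) :
    complexStr h p (frame h i p) = rotatedFrame h i p := by
  simp [complexStr, coframe_frame ht hh, -Fintype.sum_sum_type]

theorem frameMap_complexStr (ht : tCoord p ≠ 0) (hh : h (tCoord p) ≠ 0) (u : Space m) :
    frameMap h p (complexStr h p u) = stdComplex m (frameMap h p u) := by
  rw [frameMap_eq_coframe, frameMap_eq_coframe, stdComplex_apply]
  ext <;> simp [complexStr, rotatedFrame, Fintype.sum_sum_type, coframe_frame ht hh]

/-- The coframe of the example is a moving frame, and its connection form is `connForm`. -/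
theorem isMovingFrameOn (hN : IsOpen N) (hA : 0 ≤ A) (H : Admissible h A B) :
    IsMovingFrameOn (domain N A B) (metric h) (stdForm m) (frameMap h) (connForm h) where
  isOpen := isOpen_domain hN
  smooth_metric p hp := (contDiffAt_metric hA H hp.2).contDiffWithinAt
  smooth_frame p hp := (contDiffAt_frameMap hA H hp.2).contDiffWithinAt
  differentiable_form p hp := by
    obtain ⟨L, hL, -⟩ := hasFDerivAt_connForm hA H hp.2
    exact hL.differentiableAt
  symm := stdForm_comm
  nondegenerate := stdForm_nondegenerate
  metric_eq p _ := metric_apply h p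
  bijective p hp := frameMap_bijective hA H hp.2
  skew p _ u a b := by
    simp only [connForm_apply, map_sub, map_smul, sub_apply, smul_apply, smul_eq_mul,
      connOne_skew, connTwo_skew]
    ring
  torsion_free p hp u v := by
    have ht : tCoord p ≠ 0 := (hA.trans_lt hp.2.1).ne'
    have hh : h (tCoord p) ≠ 0 := H.2 _ hp.2
    rw [fderiv_frameMap hA H hp.2, fderiv_frameMap hA H hp.2, connForm_apply, connForm_apply,
      frameMap_apply, frameMap_apply]
    have e1 := dotProduct_comm v.1 u.1
    have e2 := dotProduct_comm v.2.1 u.2.1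
    have e3 := dotProduct_comm v.2.1 u.1
    have e4 := dotProduct_comm v.1 u.2.1
    ext <;> simp [connOne_apply, connTwo_apply, e1, e2, e3, e4] <;> field_simp <;> ring

end Frame

/-! ### Tensors in the orthonormal frame -/

section Derivation

/-- The action as a derivation is natural under a map intertwining the tensors and operators. -/
theorem derivationAct_map {E F : Type*} {k : ℕ} {A : E → E} {T : (Fin k → E) → ℝ} {A' : F → F}
    {T' : (Fin k → F) → ℝ} (φ : E → F) (hT : ∀ X, T X = T' (φ ∘ X))
    (hA : ∀ x, φ (A x) = A' (φ x)) (X : Fin k → E) :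
    derivationAct A T X = derivationAct A' T' (φ ∘ X) := by
  simp only [derivationAct, hT, Function.comp_update, hA, Function.comp_apply]

theorem derivationAct_smul_add {F : Type*} [AddCommGroup F] [Module ℝ F] {k : ℕ} {A D : F → F}
    {T : (Fin k → F) → ℝ}
    (hT : ∀ Y s r x y, T (Function.update Y s (r • x + y)) =
      r * T (Function.update Y s x) + T (Function.update Y s y)) (r : ℝ) (Y : Fin k → F) :
    derivationAct (fun x => r • A x + D x) T Y = r * derivationAct A T Y + derivationAct D T Y := by
  simp only [derivationAct, hT, Finset.sum_add_distrib, ← Finset.mul_sum]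
  ring

end Derivation

section Model

variable {m : ℕ}

theorem modelRiemann_update (f μ ν : ℝ) (Y : Fin 4 → Space m) (s : Fin 4) (r : ℝ)
    (x y : Space m) : modelRiemann m f μ ν (Function.update Y s (r • x + y)) =
      r * modelRiemann m f μ ν (Function.update Y s x)
        + modelRiemann m f μ ν (Function.update Y s y) := by
  fin_cases s <;>
  · simp only [modelRiemann_eq, holCurv, Function.update_apply, Fin.reduceEq, Fin.reduceFinMk,
      Fin.isValue, Fin.zero_eta, Fin.mk_one, if_true, if_false, map_add, map_sub, map_smul,
      add_apply, sub_apply, smul_apply, smul_eq_mul]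
    ring

/-- Holomorphic pseudosymmetry on the model space: only the summand `f R^H` of the curvature
operator acts nontrivially on the curvature tensor. -/
theorem derivationAct_modelCurv_modelRiemann (f μ ν : ℝ) (a b : Space m) (Y : Fin 4 → Space m) :
    derivationAct (modelCurv m f μ ν a b) (modelRiemann m f μ ν) Y =
      f * derivationAct (holCurv (stdComplex m) (stdForm m) a b) (modelRiemann m f μ ν) Y := by
  have h := derivationAct_smul_add (A := holCurv (stdComplex m) (stdForm m) a b)
    (D := splitCurv m μ ν a b) (modelRiemann_update f μ ν) f Y
  rw [derivationAct_splitCurv_modelRiemann, add_zero] at h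
  exact h

theorem derivationAct_modelCurv_splitForm (f μ ν σ τ : ℝ) (a b : Space m) (Y : Fin 2 → Space m) :
    derivationAct (modelCurv m f μ ν a b) (fun Y => splitForm m σ τ (Y 0) (Y 1)) Y =
      f * derivationAct (holCurv (stdComplex m) (stdForm m) a b)
        (fun Y => splitForm m σ τ (Y 0) (Y 1)) Y := by
  have h := derivationAct_smul_add (A := holCurv (stdComplex m) (stdForm m) a b)
    (D := splitCurv m μ ν a b) (T := fun Y => splitForm m σ τ (Y 0) (Y 1)) (fun Y s r x y => by
      fin_cases s <;>
      · simp [splitForm]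
        ring) f Y
  have h0 : derivationAct (splitCurv m μ ν a b) (fun Y => splitForm m σ τ (Y 0) (Y 1)) Y = 0 := by
    simp [derivationAct, Fin.sum_univ_two, splitForm_splitCurv]
  rw [h0, add_zero] at h
  exact h

theorem derivationAct_modelCurv_components_of_ne (f μ ν : ℝ) {α β : Fin m} (hαβ : α ≠ β) :
    derivationAct (modelCurv m f μ ν (Pi.single α 1, 0, 0, 0) (0, 0, 1, 0))
      (modelRiemann m f μ ν)
      ![(Pi.single α 1, 0, 0, 0), (Pi.single β 1, 0, 0, 0), (Pi.single β 1, 0, 0, 0), (0, 0, 1, 0)]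
      = -(f * μ) := by
  rw [derivationAct_modelCurv_modelRiemann, derivationAct_four]
  simp [modelRiemann_eq, holCurv, stdForm_apply, stdComplex_apply, horProj_apply, verProj_apply,
    hαβ.symm]

theorem derivationAct_modelCurv_components_self (f μ ν : ℝ) (α : Fin m) :
    derivationAct (modelCurv m f μ ν (Pi.single α 1, 0, 0, 0) (0, 0, 1, 0))
      (modelRiemann m f μ ν)
      ![(Pi.single α 1, 0, 0, 0), (0, Pi.single α 1, 0, 0), (0, Pi.single α 1, 0, 0), (0, 0, 1, 0)]
      = -(4 * (f * μ)) := by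
  rw [derivationAct_modelCurv_modelRiemann, derivationAct_four]
  simp [modelRiemann_eq, holCurv, stdForm_apply, stdComplex_apply, horProj_apply, verProj_apply]
  ring

end Model

/-! ### The curvature of the example -/

section Curvature

variable {m : ℕ} {N : Set ((Fin m → ℝ) × (Fin m → ℝ) × ℝ)} {A B : ℝ} {h : ℝ → ℝ} {p : Space m}

/-- The weight of the horizontal part of the curvature, `t h h'`. -/
noncomputable def horCoeff (h : ℝ → ℝ) (t : ℝ) : ℝ := t * h t * deriv h t

/-- The weight of the vertical part of the curvature, `-(3 t h h' + t² (h h')') / 4`. -/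
noncomputable def verCoeff (h : ℝ → ℝ) (t : ℝ) : ℝ :=
  -(3 * t * h t * deriv h t + t ^ 2 * (h t * deriv (deriv h) t + deriv h t ^ 2)) / 4

/-- The Ricci curvature on the span of the `e_α` and `e_α'`. -/
noncomputable def ricciHor (m : ℕ) (h : ℝ → ℝ) (t : ℝ) : ℝ :=
  2 * (m + 2) * structureFun h t + 2 * (m + 1) * horCoeff h t

/-- The Ricci curvature on the span of `e_{2m+1}` and `e_{2m+2}`. -/
noncomputable def ricciVer (m : ℕ) (h : ℝ → ℝ) (t : ℝ) : ℝ :=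
  2 * (m + 2) * structureFun h t + 4 * verCoeff h t

theorem tCoord_ne_zero (hA : 0 ≤ A) (hp : p ∈ domain N A B) : tCoord p ≠ 0 :=
  (hA.trans_lt hp.2.1).ne'

theorem isKahlerOn (hN : IsOpen N) (hA : 0 ≤ A) (H : Admissible h A B) :
    IsKahlerOn (domain N A B) (complexStr h) (metric h) := by
  have F := isMovingFrameOn hN hA H
  have hJ (p) (hp : p ∈ domain N A B) (u) :
      frameMap h p (complexStr h p u) = stdComplex m (frameMap h p u) :=
    frameMap_complexStr (tCoord_ne_zero hA hp) (H.2 _ hp.2) u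
  have hsm : ContDiffOn ℝ ∞ (complexStr h) (domain N A B) :=
    fun p hp => (contDiffAt_complexStr hA H hp.2).contDiffWithinAt
  have S := isHermitianForm_std (m := m)
  refine ⟨F.smooth_metric, hsm, fun p hp u v => ?_, fun p hp u hu => ?_, fun p hp u => ?_,
    fun p hp u v => ?_, fun X Y _ hY p hp => ?_⟩
  · rw [F.metric_eq p hp, F.metric_eq p hp, S.symm]
  · rw [F.metric_eq p hp]
    exact stdForm_self_pos _ fun h0 => hu ((F.bijective p hp).1 (h0.trans (map_zero _).symm))
  · apply (F.bijective p hp).1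
    rw [hJ p hp, hJ p hp, S.sq_eq_neg, map_neg]
  · rw [F.metric_eq p hp, F.metric_eq p hp, hJ p hp, hJ p hp, S.skew, S.sq_eq_neg]
    simp
  · refine F.nabla_endomorphism hsm hJ (fun q _ u a => ?_) X
      ((hY.contDiffAt (F.isOpen.mem_nhds hp)).differentiableAt (by simp)) hp
    simp only [connForm_apply, connOne_stdComplex, connTwo_stdComplex, map_sub, map_smul]

/-- The curvature operator of the example in the orthonormal frame. -/
theorem frameMap_curv (hN : IsOpen N) (hA : 0 ≤ A) (H : Admissible h A B)
    (hp : p ∈ domain N A B) (u v w : Space m) :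
    frameMap h p (curv (metric h) p u v w) =
      modelCurv m (structureFun h (tCoord p)) (horCoeff h (tCoord p)) (verCoeff h (tCoord p))
        (frameMap h p u) (frameMap h p v) (frameMap h p w) := by
  have F := isMovingFrameOn hN hA H
  obtain ⟨L, hL, hL'⟩ := hasFDerivAt_connForm (m := m) hA H hp.2
  have ht := tCoord_ne_zero hA hp
  have hh := H.2 _ hp.2
  -- `dt` is `t h` times the last coframe element.
  have e (x : Space m) :
      x.2.2.2 = tCoord p * h (tCoord p) * (frameMap h p x).2.2.2 := by
    rw [frameMap_apply]; field_simp
  -- The first structure equation replaces `dΘ` by terms without derivatives.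
  have tor : fderiv ℝ (frameMap h) p u v = fderiv ℝ (frameMap h) p v u
      + connForm h p v (frameMap h p u) - connForm h p u (frameMap h p v) :=
    eq_sub_of_add_eq (F.torsion_free p hp u v)
  have key := connection_curvature (m := m) (tCoord p) (h (tCoord p)) (deriv h (tCoord p))
    (deriv (deriv h) (tCoord p))
    (fun a b => h (tCoord p) • connOne m a b
      - (h (tCoord p) + tCoord p * deriv h (tCoord p)) • connTwo m a b) (fun _ _ => rfl)
    (frameMap h p u) (frameMap h p v) (frameMap h p w)
  rw [← e, ← e] at key
  rw [F.frame_curv hp, hL.fderiv, hL', hL', structureFun, horCoeff, verCoeff, tor]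
  refine Eq.trans ?_ key
  simp only [connForm_apply, map_add, map_sub, map_smul, add_apply, sub_apply, smul_apply]
  module

theorem frameMap_curvH (hA : 0 ≤ A) (H : Admissible h A B)
    (hp : p ∈ domain N A B) (u v w : Space m) :
    frameMap h p (curvH (complexStr h) (metric h) p u v w) =
      holCurv (stdComplex m) (stdForm m) (frameMap h p u) (frameMap h p v) (frameMap h p w) := by
  have hJ := frameMap_complexStr (tCoord_ne_zero hA hp) (H.2 _ hp.2)
  simp only [curvH, holCurv, map_add, map_sub, map_smul, metric_apply, hJ]

/-- The Riemann tensor is the pullback of `modelRiemann`, with coefficients depending on `t`. -/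
theorem riemann_eq (hN : IsOpen N) (hA : 0 ≤ A) (H : Admissible h A B)
    (hp : p ∈ domain N A B) (X : Fin 4 → Space m) :
    riemann (metric h) p X = modelRiemann m (structureFun h (tCoord p)) (horCoeff h (tCoord p))
      (verCoeff h (tCoord p)) (frameMap h p ∘ X) := by
  rw [riemann, metric_apply, frameMap_curv hN hA H hp]
  rfl

theorem curvDot_riemann (hN : IsOpen N) (hA : 0 ≤ A) (H : Admissible h A B)
    (hp : p ∈ domain N A B) (U V : Space m) (X : Fin 4 → Space m) :
    curvDot (metric h) (riemann (metric h)) p U V X =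
      derivationAct (modelCurv m (structureFun h (tCoord p)) (horCoeff h (tCoord p))
        (verCoeff h (tCoord p)) (frameMap h p U) (frameMap h p V))
        (modelRiemann m (structureFun h (tCoord p)) (horCoeff h (tCoord p))
        (verCoeff h (tCoord p))) (frameMap h p ∘ X) :=
  derivationAct_map _ (riemann_eq hN hA H hp) (frameMap_curv hN hA H hp U V) X

theorem isHolPseudosymmetricOn (hN : IsOpen N) (hA : 0 ≤ A) (H : Admissible h A B) :
    IsHolPseudosymmetricOn (domain N A B) (complexStr h) (metric h)
      (fun p => structureFun h (tCoord p)) := by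
  intro p hp U V X
  rw [curvDot_riemann hN hA H hp, derivationAct_modelCurv_modelRiemann]
  exact congrArg _ (derivationAct_map _ (riemann_eq hN hA H hp)
    (frameMap_curvH hA H hp U V) X).symm

theorem frameMap_frame (ht : tCoord p ≠ 0) (hh : h (tCoord p) ≠ 0) (i : Idx m) :
    frameMap h p (frame h i p) = (fun α => if ix α = i then 1 else 0,
      fun α => if iy α = i then 1 else 0, if iz = i then 1 else 0, if it = i then 1 else 0) := by
  simp only [frameMap_eq_coframe, coframe_frame ht hh]

theorem frameMap_frame_ix (ht : tCoord p ≠ 0) (hh : h (tCoord p) ≠ 0) (α : Fin m) :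
    frameMap h p (frame h (ix α) p) = (Pi.single α 1, 0, 0, 0) := by
  rw [frameMap_frame ht hh]
  ext <;> simp [Pi.single_apply]

theorem frameMap_frame_iy (ht : tCoord p ≠ 0) (hh : h (tCoord p) ≠ 0) (α : Fin m) :
    frameMap h p (frame h (iy α) p) = (0, Pi.single α 1, 0, 0) := by
  rw [frameMap_frame ht hh]
  ext <;> simp [Pi.single_apply]

theorem frameMap_frame_iz (ht : tCoord p ≠ 0) (hh : h (tCoord p) ≠ 0) :
    frameMap h p (frame h iz p) = (0, 0, 1, 0) := by
  rw [frameMap_frame ht hh]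
  ext <;> simp

theorem curvDot_riemann_frame_of_ne (hN : IsOpen N) (hA : 0 ≤ A) (H : Admissible h A B)
    (hp : p ∈ domain N A B) {α β : Fin m} (hαβ : α ≠ β) :
    curvDot (metric h) (riemann (metric h)) p (frame h (ix α) p) (frame h iz p)
        ![frame h (ix α) p, frame h (ix β) p, frame h (ix β) p, frame h iz p] =
      -(structureFun h (tCoord p) * horCoeff h (tCoord p)) := by
  have ht := tCoord_ne_zero hA hp
  have hh := H.2 _ hp.2
  have hX : frameMap h p ∘ ![frame h (ix α) p, frame h (ix β) p, frame h (ix β) p, frame h iz p] =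
      ![(Pi.single α 1, 0, 0, 0), (Pi.single β 1, 0, 0, 0), (Pi.single β 1, 0, 0, 0),
        (0, 0, 1, 0)] := by
    rw [← frameMap_frame_ix ht hh, ← frameMap_frame_ix ht hh, ← frameMap_frame_iz ht hh]
    funext i
    fin_cases i <;> rfl
  rw [curvDot_riemann hN hA H hp, hX, frameMap_frame_ix ht hh, frameMap_frame_iz ht hh,
    derivationAct_modelCurv_components_of_ne _ _ _ hαβ]

theorem curvDot_riemann_frame_self (hN : IsOpen N) (hA : 0 ≤ A) (H : Admissible h A B)
    (hp : p ∈ domain N A B) (α : Fin m) :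
    curvDot (metric h) (riemann (metric h)) p (frame h (ix α) p) (frame h iz p)
        ![frame h (ix α) p, frame h (iy α) p, frame h (iy α) p, frame h iz p] =
      -(4 * (structureFun h (tCoord p) * horCoeff h (tCoord p))) := by
  have ht := tCoord_ne_zero hA hp
  have hh := H.2 _ hp.2
  have hX : frameMap h p ∘ ![frame h (ix α) p, frame h (iy α) p, frame h (iy α) p, frame h iz p] =
      ![(Pi.single α 1, 0, 0, 0), (0, Pi.single α 1, 0, 0), (0, Pi.single α 1, 0, 0),
        (0, 0, 1, 0)] := by
    rw [← frameMap_frame_ix ht hh, ← frameMap_frame_iy ht hh, ← frameMap_frame_iz ht hh]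
    funext i
    fin_cases i <;> rfl
  rw [curvDot_riemann hN hA H hp, hX, frameMap_frame_ix ht hh, frameMap_frame_iz ht hh,
    derivationAct_modelCurv_components_self]

theorem ricci_eq (hN : IsOpen N) (hA : 0 ≤ A) (H : Admissible h A B)
    (hp : p ∈ domain N A B) (u v : Space m) :
    ricci (metric h) p u v = splitForm m (ricciHor m h (tCoord p)) (ricciVer m h (tCoord p))
      (frameMap h p u) (frameMap h p v) := by
  let e : Space m ≃ₗ[ℝ] Space m :=
    LinearEquiv.ofBijective (frameMap h p : Space m →ₗ[ℝ] Space m) (frameMap_bijective hA H hp.2)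
  have h1 : ricci (metric h) p u v = LinearMap.trace ℝ _ (curvEndo (metric h) p u v) := rfl
  rw [h1, ← LinearMap.trace_conj' _ e]
  refine trace_modelCurv (structureFun h (tCoord p)) (horCoeff h (tCoord p))
    (verCoeff h (tCoord p)) _ _ _ fun x => ?_
  obtain ⟨y, rfl⟩ := e.surjective x
  rw [LinearEquiv.conj_apply_apply, LinearEquiv.symm_apply_apply]
  exact frameMap_curv hN hA H hp y u v

theorem isHolRicciPseudosymmetricOn (hN : IsOpen N) (hA : 0 ≤ A) (H : Admissible h A B) :
    IsHolRicciPseudosymmetricOn (domain N A B) (complexStr h) (metric h)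
      (fun p => structureFun h (tCoord p)) := by
  intro p hp U V X
  have hT (X : Fin 2 → Space m) := ricci_eq hN hA H hp (X 0) (X 1)
  have h1 := derivationAct_map (T := ricciTensor (metric h) p) (T' := fun Y => splitForm m
    (ricciHor m h (tCoord p)) (ricciVer m h (tCoord p)) (Y 0) (Y 1)) _ hT
    (frameMap_curv hN hA H hp U V) X
  have h2 := derivationAct_map (T := ricciTensor (metric h) p) (T' := fun Y => splitForm m
    (ricciHor m h (tCoord p)) (ricciVer m h (tCoord p)) (Y 0) (Y 1)) _ hT
    (frameMap_curvH hA H hp U V) X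
  rw [derivationAct_modelCurv_splitForm, ← h2] at h1
  exact h1

theorem scalarCurvature_eq (hN : IsOpen N) (hA : 0 ≤ A) (H : Admissible h A B)
    (hp : p ∈ domain N A B) : scalarCurvature (metric (m := m) h) p =
      2 * m * ricciHor m h (tCoord p) + 2 * ricciVer m h (tCoord p) := by
  have F := isMovingFrameOn hN hA H
  let e : Space m ≃ₗ[ℝ] Space m :=
    LinearEquiv.ofBijective (frameMap h p : Space m →ₗ[ℝ] Space m) (frameMap_bijective hA H hp.2)
  set σ := ricciHor m h (tCoord p)
  set τ := ricciVer m h (tCoord p)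
  -- The frame conjugates the Ricci endomorphism to `σ` times the horizontal plus `τ` times the
  -- vertical projection.
  have h1 : (σ • (horProj m : Space m →ₗ[ℝ] Space m) + τ • (verProj m : Space m →ₗ[ℝ] Space m)) =
      e.conj (((metric h p).inverse : (Space m →L[ℝ] ℝ) →ₗ[ℝ] Space m) ∘ₗ
      (LinearMap.toContinuousLinearMap : (Space m →ₗ[ℝ] ℝ) ≃ₗ[ℝ] (Space m →L[ℝ] ℝ)).toLinearMap
        ∘ₗ ricci (metric h) p) := by
    refine LinearMap.ext fun x => ?_
    obtain ⟨u, rfl⟩ := e.surjective x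
    rw [LinearEquiv.conj_apply_apply, LinearEquiv.symm_apply_apply]
    obtain ⟨w, hw⟩ := e.surjective (σ • horProj m (e u) + τ • verProj m (e u))
    have h2 : LinearMap.toContinuousLinearMap (ricci (metric h) p u) = metric h p w := by
      refine ContinuousLinearMap.ext fun v => ?_
      have h3 : metric h p w v = stdForm m (e w) (e v) := metric_apply h p w v
      rw [h3, hw, LinearMap.coe_toContinuousLinearMap', ricci_eq hN hA H hp]
      simp only [splitForm, map_add, map_smul, add_apply, smul_apply, smul_eq_mul]
      rfl
    simp only [LinearMap.comp_apply, LinearEquiv.coe_coe, ContinuousLinearMap.coe_coe]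
    rw [h2, F.inverse_metric_apply hp, hw]
    rfl
  rw [scalarCurvature, ← LinearMap.trace_conj' _ e, ← h1, map_add, map_smul, map_smul,
    trace_horProj, trace_verProj]
  simp only [smul_eq_mul]
  ring

theorem isEinsteinOn (hN : IsOpen N) (hA : 0 ≤ A) (H : Admissible h A B) {l : ℝ}
    (hσ : ∀ t ∈ Ioo A B, ricciHor m h t = l) (hτ : ∀ t ∈ Ioo A B, ricciVer m h t = l) :
    IsEinsteinOn (domain N A B) (metric h) := by
  refine ⟨l, fun p hp u v => ?_⟩
  rw [ricci_eq hN hA H hp, hσ _ hp.2, hτ _ hp.2, splitForm, metric_apply]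
  rw [← mul_add, ← add_apply, ← map_add]
  congr 3
  ext <;> simp [horProj_apply, verProj_apply]

theorem not_isSemisymmetricOn (hm : 1 ≤ m) (hN : IsOpen N) (hA : 0 ≤ A) (H : Admissible h A B)
    (hp : p ∈ domain N A B) (hf : structureFun h (tCoord p) ≠ 0)
    (hμ : horCoeff h (tCoord p) ≠ 0) : ¬ IsSemisymmetricOn (domain N A B) (metric (m := m) h) := by
  intro hs
  have h1 := curvDot_riemann_frame_self hN hA H hp ⟨0, hm⟩
  rw [hs p hp] at h1
  have := mul_ne_zero hf hμ
  apply this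
  linarith

end Curvature

/-! ### Topology of the domain -/

section Domain

variable {m : ℕ} {N : Set ((Fin m → ℝ) × (Fin m → ℝ) × ℝ)} {A B : ℝ}

theorem domain_eq_image : (domain N A B : Set (Space m)) =
    (fun q : ((Fin m → ℝ) × (Fin m → ℝ) × ℝ) × ℝ => (q.1.1, q.1.2.1, q.1.2.2, q.2)) ''
      (N ×ˢ Ioo A B) := by
  ext p
  constructor
  · rintro ⟨h1, h2⟩
    exact ⟨((p.1, p.2.1, p.2.2.1), p.2.2.2), ⟨h1, h2⟩, rfl⟩
  · rintro ⟨q, ⟨h1, h2⟩, rfl⟩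
    exact ⟨h1, h2⟩

theorem isConnected_domain (hNc : IsConnected N) (hAB : A < B) :
    IsConnected (domain N A B : Set (Space m)) := by
  rw [domain_eq_image]
  exact (hNc.prod (isConnected_Ioo hAB)).image _ (by fun_prop)

theorem image_tCoord_domain (hNc : N.Nonempty) :
    (fun p : Space m => tCoord p) '' domain N A B = Ioo A B := by
  obtain ⟨x, hx⟩ := hNc
  ext t
  constructor
  · rintro ⟨p, hp, rfl⟩
    exact hp.2
  · exact fun ht => ⟨(x.1, x.2.1, x.2.2, t), ⟨hx, ht⟩, rfl⟩

theorem not_isCompact_domain (hNc : N.Nonempty) (hAB : A < B) :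
    ¬ IsCompact (domain N A B : Set (Space m)) := by
  intro hc
  have h := hc.image (by fun_prop : Continuous fun p : Space m => tCoord p)
  rw [image_tCoord_domain hNc, isCompact_Ioo_iff] at h
  exact absurd hAB h.not_gt

end Domain

/-! ### The profiles with constant scalar curvature -/

section Profile

variable {m : ℕ} {A B a b c : ℝ} {h : ℝ → ℝ} {t : ℝ}

theorem profile_admissible (hA : 0 ≤ A)
    (hq : ∀ t ∈ Ioo A B, 0 < a + b * t ^ 2 + c * t ^ (4 + 2 * m)) :
    Admissible (profile m a b c) A B := by
  refine ⟨fun t ht => ?_, fun t ht => ?_⟩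
  · have h1 : ContDiffAt ℝ ∞ (fun t : ℝ => a + b * t ^ 2 + c * t ^ (4 + 2 * m)) t := by fun_prop
    have h2 : ContDiffAt ℝ ∞ (fun t : ℝ => 1 / t ^ (2 + m)) t :=
      contDiffAt_const.div (contDiffAt_id.pow _) (pow_ne_zero _ (hA.trans_lt ht.1).ne')
    exact (h2.mul (h1.sqrt (hq t ht).ne')).contDiffWithinAt
  · have : 0 < t := hA.trans_lt ht.1
    have := Real.sqrt_pos.2 (hq t ht)
    unfold profile
    positivity

theorem profile_sq (ht : 0 < t) (hq : 0 < a + b * t ^ 2 + c * t ^ (4 + 2 * m)) :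
    profile m a b c t ^ 2 = a * (t ^ (4 + 2 * m))⁻¹ + b * (t ^ (2 + 2 * m))⁻¹ + c := by
  rw [profile, mul_pow, Real.sq_sqrt hq.le]
  field_simp
  ring

theorem hasDerivAt_inv_pow (n : ℕ) (ht : t ≠ 0) :
    HasDerivAt (fun t : ℝ => (t ^ n)⁻¹) (-(n : ℝ) * (t ^ (n + 1))⁻¹) t := by
  have h := hasDerivAt_zpow (-(n : ℤ)) t (Or.inl ht)
  have e : -(n : ℤ) - 1 = -((n + 1 : ℕ) : ℤ) := by push_cast; ring
  rw [e] at h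
  simpa only [zpow_neg, zpow_natCast, Int.cast_neg, Int.cast_natCast] using h

/-- The derivatives of `h` enter the curvature only through those of `h²`. -/
theorem Admissible.mul_deriv (H : Admissible h A B) {q q₁ : ℝ → ℝ}
    (hq : ∀ t ∈ Ioo A B, h t ^ 2 = q t) (hq₁ : ∀ t ∈ Ioo A B, HasDerivAt q (q₁ t) t)
    (ht : t ∈ Ioo A B) : 2 * (h t * deriv h t) = q₁ t := by
  have h1 := (H.hasDerivAt ht).pow 2
  have h2 : h ^ 2 =ᶠ[nhds t] q := by
    filter_upwards [isOpen_Ioo.mem_nhds ht] with s hs using hq s hs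
  have h3 := h1.unique ((hq₁ t ht).congr_of_eventuallyEq h2)
  simp at h3
  linarith

theorem Admissible.mul_deriv_deriv (H : Admissible h A B) {q q₁ : ℝ → ℝ} {q₂ : ℝ}
    (hq : ∀ t ∈ Ioo A B, h t ^ 2 = q t) (hq₁ : ∀ t ∈ Ioo A B, HasDerivAt q (q₁ t) t)
    (ht : t ∈ Ioo A B) (hq₂ : HasDerivAt q₁ q₂ t) :
    2 * (h t * deriv (deriv h) t + deriv h t ^ 2) = q₂ := by
  have h1 := ((H.hasDerivAt ht).mul (H.hasDerivAt_deriv ht)).const_mul 2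
  have h2 : (fun s => 2 * (h * deriv h) s) =ᶠ[nhds t] q₁ := by
    filter_upwards [isOpen_Ioo.mem_nhds ht] with s hs using H.mul_deriv hq hq₁ hs
  have h3 := h1.unique (hq₂.congr_of_eventuallyEq h2)
  linarith

/-- The expressions `h t h'` and `t² (h h')'` for the profile, from the derivatives of `h²`. -/
theorem profile_derivs (hA : 0 ≤ A)
    (hq : ∀ t ∈ Ioo A B, 0 < a + b * t ^ 2 + c * t ^ (4 + 2 * m)) (ht : t ∈ Ioo A B) :
    profile m a b c t * deriv (profile m a b c) t * t =
        -(a * (m + 2) * (t ^ (4 + 2 * m))⁻¹ + b * (m + 1) * (t ^ (2 + 2 * m))⁻¹) ∧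
      t ^ 2 * (profile m a b c t * deriv (deriv (profile m a b c)) t
          + deriv (profile m a b c) t ^ 2) =
        a * (m + 2) * (2 * m + 5) * (t ^ (4 + 2 * m))⁻¹
          + b * (m + 1) * (2 * m + 3) * (t ^ (2 + 2 * m))⁻¹ := by
  have H := profile_admissible hA hq
  have ht0 : t ≠ 0 := (hA.trans_lt ht.1).ne'
  have h0 : ∀ t ∈ Ioo A B, profile m a b c t ^ 2 =
      a * (t ^ (4 + 2 * m))⁻¹ + b * (t ^ (2 + 2 * m))⁻¹ + c :=
    fun t ht => profile_sq (hA.trans_lt ht.1) (hq t ht)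
  have h1 (t) (ht : t ∈ Ioo A B) :=
    (((hasDerivAt_inv_pow (4 + 2 * m) (hA.trans_lt ht.1).ne').const_mul a).add
      ((hasDerivAt_inv_pow (2 + 2 * m) (hA.trans_lt ht.1).ne').const_mul b)).add_const c
  have h2 := (((hasDerivAt_inv_pow (4 + 2 * m + 1) ht0).const_mul
        (-((4 + 2 * m : ℕ) : ℝ))).const_mul a).add (((hasDerivAt_inv_pow (2 + 2 * m + 1) ht0).const_mul
        (-((2 + 2 * m : ℕ) : ℝ))).const_mul b)
  have e1 := H.mul_deriv h0 h1 ht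
  have e2 := H.mul_deriv_deriv h0 h1 ht h2
  constructor
  · rw [← mul_left_cancel_iff_of_pos (two_pos : (0 : ℝ) < 2), ← mul_assoc, e1]
    push_cast
    field_simp
    ring
  · rw [← mul_left_cancel_iff_of_pos (two_pos : (0 : ℝ) < 2), mul_left_comm, e2]
    push_cast
    field_simp
    ring

theorem structureFun_profile (hA : 0 ≤ A)
    (hq : ∀ t ∈ Ioo A B, 0 < a + b * t ^ 2 + c * t ^ (4 + 2 * m)) (ht : t ∈ Ioo A B) :
    structureFun (profile m a b c) t =
      a * (m + 1) * (t ^ (4 + 2 * m))⁻¹ + b * m * (t ^ (2 + 2 * m))⁻¹ - c := by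
  have h0 := profile_sq (hA.trans_lt ht.1) (hq t ht)
  have h1 := (profile_derivs hA hq ht).1
  rw [structureFun]
  linear_combination -h0 - h1

theorem horCoeff_profile (hA : 0 ≤ A)
    (hq : ∀ t ∈ Ioo A B, 0 < a + b * t ^ 2 + c * t ^ (4 + 2 * m)) (ht : t ∈ Ioo A B) :
    horCoeff (profile m a b c) t =
      -(a * (m + 2) * (t ^ (4 + 2 * m))⁻¹ + b * (m + 1) * (t ^ (2 + 2 * m))⁻¹) := by
  have h1 := (profile_derivs hA hq ht).1
  rw [horCoeff]
  linear_combination h1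

theorem ricciHor_profile (hA : 0 ≤ A)
    (hq : ∀ t ∈ Ioo A B, 0 < a + b * t ^ 2 + c * t ^ (4 + 2 * m)) (ht : t ∈ Ioo A B) :
    ricciHor m (profile m a b c) t = -2 * c * (m + 2) - 2 * b * (t ^ (2 + 2 * m))⁻¹ := by
  rw [ricciHor, structureFun_profile hA hq ht, horCoeff_profile hA hq ht]
  ring

theorem ricciVer_profile (hA : 0 ≤ A)
    (hq : ∀ t ∈ Ioo A B, 0 < a + b * t ^ 2 + c * t ^ (4 + 2 * m)) (ht : t ∈ Ioo A B) :
    ricciVer m (profile m a b c) t = -2 * c * (m + 2) + 2 * m * b * (t ^ (2 + 2 * m))⁻¹ := by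
  obtain ⟨h1, h2⟩ := profile_derivs hA hq ht
  rw [ricciVer, structureFun_profile hA hq ht, verCoeff]
  linear_combination -3 * h1 - h2

theorem scalarCurvature_profile {N : Set ((Fin m → ℝ) × (Fin m → ℝ) × ℝ)} {p : Space m}
    (hN : IsOpen N) (hA : 0 ≤ A)
    (hq : ∀ t ∈ Ioo A B, 0 < a + b * t ^ 2 + c * t ^ (4 + 2 * m)) (hp : p ∈ domain N A B) :
    scalarCurvature (metric (m := m) (profile m a b c)) p = -4 * c * (m + 1) * (m + 2) := by
  rw [scalarCurvature_eq hN hA (profile_admissible hA hq) hp, ricciHor_profile hA hq hp.2,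
    ricciVer_profile hA hq hp.2]
  ring

/-- For `b = 0` both Ricci curvatures are equal to `-2 c (m + 2)`. -/
theorem isEinsteinOn_profile {N : Set ((Fin m → ℝ) × (Fin m → ℝ) × ℝ)} (hN : IsOpen N)
    (hA : 0 ≤ A) (hq : ∀ t ∈ Ioo A B, 0 < a + 0 * t ^ 2 + c * t ^ (4 + 2 * m)) :
    IsEinsteinOn (domain N A B) (metric (m := m) (profile m a 0 c)) :=
  isEinsteinOn hN hA (profile_admissible hA hq) (l := -2 * c * (m + 2))
    (fun t ht => by rw [ricciHor_profile hA hq ht]; ring)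
    (fun t ht => by rw [ricciVer_profile hA hq ht]; ring)

end Profile

/-! ### Covariant derivatives of the curvature -/

section Parallel

variable {m : ℕ} {N : Set ((Fin m → ℝ) × (Fin m → ℝ) × ℝ)} {A B : ℝ} {h : ℝ → ℝ} {p : Space m}

theorem nablaTensor_eq {E : Type*} [NormedAddCommGroup E] [NormedSpace ℝ E] {k : ℕ}
    (g : E → E →L[ℝ] E →L[ℝ] ℝ) (T : E → (Fin k → E) → ℝ) (p u : E) (X : Fin k → E) :
    nablaTensor g T p u X =
      fderiv ℝ (fun q => T q X) p u + derivationAct (christoffel g p u) (T p) X := by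
  rw [nablaTensor, derivationAct, sub_eq_add_neg]

theorem derivationAct_two {E : Type*} (A : E → E) (T : (Fin 2 → E) → ℝ) (a b : E) :
    derivationAct A T ![a, b] = -(T ![A a, b] + T ![a, A b]) := by
  simp only [derivationAct, Fin.sum_univ_two]
  congr 2 <;> congr 1 <;> ext i <;> fin_cases i <;> rfl

/-- The connection form vanishes on `∂_t`: the frame is parallel along the curves with tangent
`∂_t`. -/
theorem frameMap_christoffel_dt (hN : IsOpen N) (hA : 0 ≤ A) (H : Admissible h A B)
    (hp : p ∈ domain N A B) (v : Space m) :
    frameMap h p (christoffel (metric h) p (0, 0, 0, 1) v) =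
      fderiv ℝ (frameMap h) p (0, 0, 0, 1) v := by
  rw [(isMovingFrameOn hN hA H).frame_christoffel hp, connForm_apply, frameMap_apply,
    add_eq_left]
  ext <;> simp [connOne_apply, connTwo_apply]

theorem christoffel_dt_dx (hN : IsOpen N) (hA : 0 ≤ A) (H : Admissible h A B)
    (hp : p ∈ domain N A B) (α : Fin m) :
    christoffel (metric h) p (0, 0, 0, 1) (Pi.single α 1, 0, 0, 0) =
      (1 / tCoord p) • ((Pi.single α 1, 0, 0, 0) : Space m) := by
  have ht := tCoord_ne_zero hA hp
  apply (frameMap_bijective hA H hp.2).1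
  rw [frameMap_christoffel_dt hN hA H hp, fderiv_frameMap hA H hp.2, map_smul, frameMap_apply]
  ext <;> simp [ht]

theorem christoffel_dt_dt (hN : IsOpen N) (hA : 0 ≤ A) (H : Admissible h A B)
    (hp : p ∈ domain N A B) :
    christoffel (metric h) p (0, 0, 0, 1) (0, 0, 0, 1) =
      (-(1 / tCoord p + deriv h (tCoord p) / h (tCoord p))) • ((0, 0, 0, 1) : Space m) := by
  have ht := tCoord_ne_zero hA hp
  have hh := H.2 _ hp.2
  apply (frameMap_bijective hA H hp.2).1
  rw [frameMap_christoffel_dt hN hA H hp, fderiv_frameMap hA H hp.2, map_smul, frameMap_apply]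
  ext <;> simp
  field_simp

theorem fderiv_eq_of_forall_domain {T : Space m → ℝ} {φ : ℝ → ℝ} {φ' : ℝ} (hN : IsOpen N)
    (hp : p ∈ domain N A B) (hT : ∀ q ∈ domain N A B, T q = φ (tCoord q))
    (hφ : HasDerivAt φ φ' (tCoord p)) : fderiv ℝ T p (0, 0, 0, 1) = φ' := by
  have h1 : T =ᶠ[nhds p] fun q => φ (tCoord q) := by
    filter_upwards [(isOpen_domain hN).mem_nhds hp] with q hq using hT q hq
  rw [h1.fderiv_eq, (hasFDerivAt_tCoord_comp hφ).fderiv]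
  simp [dt]

theorem ricciTensor_dx_dx (hN : IsOpen N) (hA : 0 ≤ A) (H : Admissible h A B)
    (hp : p ∈ domain N A B) (α : Fin m) :
    ricciTensor (metric h) p ![(Pi.single α 1, 0, 0, 0), (Pi.single α 1, 0, 0, 0)] =
      ricciHor m h (tCoord p) * tCoord p ^ 2 := by
  simp [ricciTensor, ricci_eq hN hA H hp, splitForm, stdForm_apply, frameMap_apply,
    horProj_apply, verProj_apply]
  exact Or.inl (sq _).symm

/-- The plane of `∂_x` and `∂_t` has sectional curvature `f`, and `|∂_x| = t`,
`|∂_t| = 1 / |t h|`. -/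
theorem riemann_dx_dt_dt_dx (hN : IsOpen N) (hA : 0 ≤ A) (H : Admissible h A B)
    (hp : p ∈ domain N A B) (α : Fin m) :
    riemann (metric h) p ![(Pi.single α 1, 0, 0, 0), (0, 0, 0, 1), (0, 0, 0, 1),
      (Pi.single α 1, 0, 0, 0)] = structureFun h (tCoord p) / h (tCoord p) ^ 2 := by
  have ht := tCoord_ne_zero hA hp
  have hh := H.2 _ hp.2
  simp [riemann_eq hN hA H hp, modelRiemann_eq, holCurv, stdForm_apply, frameMap_apply,
    stdComplex_apply, horProj_apply, verProj_apply]
  field_simp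

/-- `(∇S)(∂_t; ∂_x, ∂_x) = t² σ'`, where `σ` is the Ricci curvature in the direction `∂_x`. -/
theorem not_isRicciSymmetricOn (hm : 1 ≤ m) (hN : IsOpen N) (hA : 0 ≤ A) (H : Admissible h A B)
    (hp : p ∈ domain N A B) {σ : ℝ → ℝ} {σ' : ℝ} (hσ : ∀ t ∈ Ioo A B, ricciHor m h t = σ t)
    (hσ' : HasDerivAt σ σ' (tCoord p)) (h0 : σ' ≠ 0) :
    ¬ IsRicciSymmetricOn (domain N A B) (metric (m := m) h) := by
  intro hs
  have ht := tCoord_ne_zero hA hp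
  -- Evaluate on constant coordinate vectors; the derivative of `σ t²` is corrected by the
  -- Christoffel symbols `Γ(∂_t, ∂_x) = ∂_x / t`.
  have h1 := hs p hp (0, 0, 0, 1) ![(Pi.single ⟨0, hm⟩ 1, 0, 0, 0), (Pi.single ⟨0, hm⟩ 1, 0, 0, 0)]
  have hT := ricciTensor_dx_dx hN hA H hp ⟨0, hm⟩
  rw [nablaTensor_eq, fderiv_eq_of_forall_domain (φ := fun t => σ t * t ^ 2) hN hp
    (fun q hq => by rw [ricciTensor_dx_dx hN hA H hq, hσ _ hq.2])
    (hσ'.mul (hasDerivAt_pow 2 _))] at h1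
  rw [derivationAct_two, christoffel_dt_dx hN hA H hp] at h1
  simp only [ricciTensor, Matrix.cons_val, map_smul, LinearMap.smul_apply, smul_eq_mul] at h1 hT
  rw [hT, hσ _ hp.2] at h1
  have h2 : σ' * tCoord p ^ 2 = 0 := by
    rw [← h1]
    field_simp
    push_cast
    ring
  simp [ht, h0] at h2

/-- If `f / h²` is constant, then `(∇R)(∂_t; ∂_x, ∂_t, ∂_t, ∂_x) = 2 f h' / h³`. -/
theorem not_isLocallySymmetricOn (hm : 1 ≤ m) (hN : IsOpen N) (hA : 0 ≤ A)
    (H : Admissible h A B) (hp : p ∈ domain N A B) {κ : ℝ} (hκ : κ ≠ 0)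
    (hf : ∀ t ∈ Ioo A B, structureFun h t / h t ^ 2 = κ) (h0 : deriv h (tCoord p) ≠ 0) :
    ¬ IsLocallySymmetricOn (domain N A B) (metric (m := m) h) := by
  intro hs
  have ht := tCoord_ne_zero hA hp
  have hh := H.2 _ hp.2
  have h1 := hs p hp (0, 0, 0, 1) ![(Pi.single ⟨0, hm⟩ 1, 0, 0, 0), (0, 0, 0, 1), (0, 0, 0, 1),
    (Pi.single ⟨0, hm⟩ 1, 0, 0, 0)]
  have hT := riemann_dx_dt_dt_dx hN hA H hp ⟨0, hm⟩
  rw [hf _ hp.2] at hT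
  rw [nablaTensor_eq, fderiv_eq_of_forall_domain (φ := fun _ => κ) hN hp
    (fun q hq => by rw [riemann_dx_dt_dt_dx hN hA H hq, hf _ hq.2])
    (hasDerivAt_const _ _), derivationAct_four, christoffel_dt_dx hN hA H hp,
    christoffel_dt_dt hN hA H hp] at h1
  simp only [riemann_eq hN hA H hp, modelRiemann_eq, Function.comp_apply, Matrix.cons_val,
    map_smul, holCurv, smul_apply, map_sub, map_add, sub_apply, add_apply, smul_eq_mul] at h1 hT
  have h2 : 2 * (deriv h (tCoord p) / h (tCoord p)) * κ = 0 := by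
    rw [← h1, ← hT]
    ring
  simp [h0, hh, hκ] at h2

end Parallel

end KahlerExample

theorem mainTheorem3 (m : ℕ) (hm : 1 ≤ m)
    (N : Set ((Fin m → ℝ) × (Fin m → ℝ) × ℝ)) (hN : IsOpen N) (hNc : IsConnected N)
    (A B : ℝ) (hA : 0 ≤ A) (hAB : A < B) :
    -- `M` is open, connected and non-compact
    (IsOpen (domain N A B) ∧ IsConnected (domain N A B) ∧ ¬ IsCompact (domain N A B)) ∧
    -- the structure for a general function `h`
    (∀ h : ℝ → ℝ, Admissible h A B →
      (∀ p ∈ domain N A B,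
        (∀ i j : Idx m, coframe h i p (frame h j p) = if i = j then 1 else 0) ∧
        (∀ i j : Idx m, metric h p (frame h i p) (frame h j p) = if i = j then 1 else 0) ∧
        (∀ i : Idx m, complexStr h p (frame h i p) = rotatedFrame h i p)) ∧
      IsKahlerOn (domain N A B) (complexStr h) (metric h) ∧
      IsHolPseudosymmetricOn (domain N A B) (complexStr h) (metric h)
        (fun p => structureFun h (tCoord p)) ∧
      -- the components of `R · R` that obstruct semisymmetry
      (∀ p ∈ domain N A B, ∀ α β : Fin m, α ≠ β →
        curvDot (metric h) (riemann (metric h)) p (frame h (ix α) p) (frame h iz p)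
            ![frame h (ix α) p, frame h (ix β) p, frame h (ix β) p, frame h iz p] =
          tCoord p * h (tCoord p) ^ 2 * deriv h (tCoord p) *
            (h (tCoord p) + tCoord p * deriv h (tCoord p))) ∧
      (∀ p ∈ domain N A B, ∀ α : Fin m,
        curvDot (metric h) (riemann (metric h)) p (frame h (ix α) p) (frame h iz p)
            ![frame h (ix α) p, frame h (iy α) p, frame h (iy α) p, frame h iz p] =
          4 * (tCoord p * h (tCoord p) ^ 2 * deriv h (tCoord p) *
            (h (tCoord p) + tCoord p * deriv h (tCoord p))))) ∧
    -- in general the structure is not semisymmetric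
    (∃ h : ℝ → ℝ, Admissible h A B ∧ ¬ IsSemisymmetricOn (domain N A B) (metric (m := m) h)) ∧
    -- the family with constant scalar curvature
    (∀ a b c : ℝ, (∀ t ∈ Ioo A B, 0 < a + b * t ^ 2 + c * t ^ (4 + 2 * m)) →
      Admissible (profile m a b c) A B ∧
      (∀ p ∈ domain N A B, scalarCurvature (metric (m := m) (profile m a b c)) p =
        -4 * c * (m + 1) * (m + 2)) ∧
      (∀ t ∈ Ioo A B, structureFun (profile m a b c) t =
        1 / t ^ (4 + 2 * m) * (a * (m + 1) + b * m * t ^ 2 - c * t ^ (4 + 2 * m)))) ∧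
    -- case (i): `a = c = 0`, `b = 1`
    ((∀ p ∈ domain N A B, scalarCurvature (metric (m := m) (profile m 0 1 0)) p = 0) ∧
      (∀ t ∈ Ioo A B, structureFun (profile m 0 1 0) t = m / t ^ (2 * m + 2) ∧
        0 < structureFun (profile m 0 1 0) t) ∧
      ¬ IsSemisymmetricOn (domain N A B) (metric (m := m) (profile m 0 1 0))) ∧
    -- case (ii): `a = 1`, `b = c = 0`
    ((∀ p ∈ domain N A B, scalarCurvature (metric (m := m) (profile m 1 0 0)) p = 0) ∧
      (∀ t ∈ Ioo A B, structureFun (profile m 1 0 0) t = (m + 1) / t ^ (2 * m + 4) ∧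
        0 < structureFun (profile m 1 0 0) t) ∧
      ¬ IsSemisymmetricOn (domain N A B) (metric (m := m) (profile m 1 0 0)) ∧
      IsEinsteinOn (domain N A B) (metric (m := m) (profile m 1 0 0))) ∧
    -- case (iii): `a > 0`, `b = 0`, `c = -a`, `(A,B) ⊆ (0,1)`
    (∀ a : ℝ, 0 < a → B ≤ 1 →
      (∀ p ∈ domain N A B, scalarCurvature (metric (m := m) (profile m a 0 (-a))) p =
        4 * a * (m + 1) * (m + 2)) ∧
      (∀ t ∈ Ioo A B,
        structureFun (profile m a 0 (-a)) t = a * (1 + (m + 1) / t ^ (2 * m + 4)) ∧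
        0 < structureFun (profile m a 0 (-a)) t) ∧
      ¬ IsSemisymmetricOn (domain N A B) (metric (m := m) (profile m a 0 (-a))) ∧
      IsEinsteinOn (domain N A B) (metric (m := m) (profile m a 0 (-a)))) ∧
    -- compactness cannot be dropped: on the non-compact `M` the other hypotheses hold, with
    -- constant scalar curvature and positive structure function, but neither `∇S = 0` nor `∇R = 0`
    (∃ (J : Space m → Space m →L[ℝ] Space m) (g : Space m → Space m →L[ℝ] Space m →L[ℝ] ℝ)
        (f : Space m → ℝ) (r : ℝ),
      IsKahlerOn (domain N A B) J g ∧
      IsHolPseudosymmetricOn (domain N A B) J g f ∧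
      IsHolRicciPseudosymmetricOn (domain N A B) J g f ∧
      (∀ p ∈ domain N A B, 0 < f p) ∧
      (∀ p ∈ domain N A B, scalarCurvature g p = r) ∧
      ¬ IsRicciSymmetricOn (domain N A B) g ∧
      ¬ IsLocallySymmetricOn (domain N A B) g) := by
  have hdom : ∃ p : Space m, p ∈ domain N A B := (isConnected_domain hNc hAB).nonempty
  obtain ⟨p₀, hp₀⟩ := hdom
  have hpos : ∀ t ∈ Ioo A B, 0 < t := fun t ht => hA.trans_lt ht.1
  -- The suffixes 1, 2, 3 refer to the profiles with `(a, b, c)` equal to `(0, 1, 0)`, `(1, 0, 0)`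
  -- and `(a, 0, -a)`.
  have hq1 : ∀ t ∈ Ioo A B, 0 < 0 + 1 * t ^ 2 + 0 * t ^ (4 + 2 * m) := fun t ht => by
    have := hpos t ht
    simp only [zero_mul, add_zero, zero_add, one_mul]
    positivity
  have hq2 : ∀ t ∈ Ioo A B, 0 < 1 + 0 * t ^ 2 + 0 * t ^ (4 + 2 * m) := fun t _ => by simp
  have hm0 : (0 : ℝ) < m := by exact_mod_cast hm
  have hf1 : ∀ t ∈ Ioo A B, structureFun (profile m 0 1 0) t = m / t ^ (2 * m + 2) ∧
      0 < structureFun (profile m 0 1 0) t := fun t ht => by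
    have := hpos t ht
    have e : structureFun (profile m 0 1 0) t = m / t ^ (2 * m + 2) := by
      rw [structureFun_profile hA hq1 ht, add_comm (2 * m)]
      ring
    exact ⟨e, by rw [e]; positivity⟩
  have hf2 : ∀ t ∈ Ioo A B, structureFun (profile m 1 0 0) t = (m + 1) / t ^ (2 * m + 4) ∧
      0 < structureFun (profile m 1 0 0) t := fun t ht => by
    have := hpos t ht
    have e : structureFun (profile m 1 0 0) t = (m + 1) / t ^ (2 * m + 4) := by
      rw [structureFun_profile hA hq2 ht, add_comm (2 * m)]
      ring
    exact ⟨e, by rw [e]; positivity⟩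
  have hμ1 : ∀ t ∈ Ioo A B, horCoeff (profile m 0 1 0) t ≠ 0 := fun t ht => by
    have := hpos t ht
    rw [horCoeff_profile hA hq1 ht, zero_mul, zero_mul, zero_add]
    exact neg_ne_zero.2 (by positivity)
  have hμ2 : ∀ t ∈ Ioo A B, horCoeff (profile m 1 0 0) t ≠ 0 := fun t ht => by
    have := hpos t ht
    rw [horCoeff_profile hA hq2 ht, zero_mul, zero_mul, add_zero]
    exact neg_ne_zero.2 (by positivity)
  have H1 := profile_admissible hA hq1
  have H2 := profile_admissible hA hq2
  have hns1 : ¬ IsSemisymmetricOn (domain N A B) (metric (m := m) (profile m 0 1 0)) :=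
    not_isSemisymmetricOn hm hN hA H1 hp₀ (hf1 _ hp₀.2).2.ne' (hμ1 _ hp₀.2)
  have hr1 : ∀ p ∈ domain N A B,
      scalarCurvature (metric (m := m) (profile m 0 1 0)) p = 0 := fun p hp => by
    rw [scalarCurvature_profile hN hA hq1 hp]
    ring
  refine ⟨⟨isOpen_domain hN, isConnected_domain hNc hAB, not_isCompact_domain hNc.nonempty hAB⟩,
    fun h H => ⟨fun p hp => ?_, isKahlerOn hN hA H, isHolPseudosymmetricOn hN hA H,
      fun p hp α β hαβ => ?_, fun p hp α => ?_⟩,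
    ⟨_, H1, hns1⟩,
    fun a b c hq => ⟨profile_admissible hA hq, fun p hp => scalarCurvature_profile hN hA hq hp,
      fun t ht => ?_⟩,
    ⟨hr1, hf1, hns1⟩,
    ⟨fun p hp => ?_, hf2,
      not_isSemisymmetricOn hm hN hA H2 hp₀ (hf2 _ hp₀.2).2.ne' (hμ2 _ hp₀.2),
      isEinsteinOn_profile hN hA hq2⟩,
    fun a ha hB => ?_,
    -- The Einstein profiles have `∇S = 0`, so the first profile serves as the counterexample.
    ⟨complexStr (profile m 0 1 0), metric (profile m 0 1 0),
      fun p => structureFun (profile m 0 1 0) (tCoord p), 0, isKahlerOn hN hA H1,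
      isHolPseudosymmetricOn hN hA H1, isHolRicciPseudosymmetricOn hN hA H1,
      fun p hp => (hf1 _ hp.2).2, hr1, ?_, ?_⟩⟩
  · have ht := tCoord_ne_zero hA hp
    have hh := H.2 _ hp.2
    exact ⟨coframe_frame ht hh, metric_frame ht hh, complexStr_frame ht hh⟩
  · rw [curvDot_riemann_frame_of_ne hN hA H hp hαβ, structureFun, horCoeff]
    ring
  · rw [curvDot_riemann_frame_self hN hA H hp, structureFun, horCoeff]
    ring
  · have := hpos t ht
    rw [structureFun_profile hA hq ht]
    field_simp
    ring
  · rw [scalarCurvature_profile hN hA hq2 hp]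
    ring
  · have hq3 : ∀ t ∈ Ioo A B, 0 < a + 0 * t ^ 2 + -a * t ^ (4 + 2 * m) := fun t ht => by
      have h1 : t ^ (4 + 2 * m) < 1 :=
        pow_lt_one₀ (hpos t ht).le (ht.2.trans_le hB) (by omega)
      have h2 := mul_pos ha (sub_pos.2 h1)
      linarith
    have hf3 : ∀ t ∈ Ioo A B,
        structureFun (profile m a 0 (-a)) t = a * (1 + (m + 1) / t ^ (2 * m + 4)) ∧
        0 < structureFun (profile m a 0 (-a)) t := fun t ht => by
      have := hpos t ht
      have e : structureFun (profile m a 0 (-a)) t = a * (1 + (m + 1) / t ^ (2 * m + 4)) := by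
        rw [structureFun_profile hA hq3 ht, add_comm (2 * m)]
        ring
      exact ⟨e, by rw [e]; positivity⟩
    have hμ3 : horCoeff (profile m a 0 (-a)) (tCoord p₀) ≠ 0 := by
      have := hpos _ hp₀.2
      rw [horCoeff_profile hA hq3 hp₀.2, zero_mul, zero_mul, add_zero]
      exact neg_ne_zero.2 (by positivity)
    refine ⟨fun p hp => ?_, hf3, not_isSemisymmetricOn hm hN hA (profile_admissible hA hq3) hp₀
      (hf3 _ hp₀.2).2.ne' hμ3, isEinsteinOn_profile hN hA hq3⟩
    rw [scalarCurvature_profile hN hA hq3 hp]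
    ring
  · have ht := hpos _ hp₀.2
    refine not_isRicciSymmetricOn hm hN hA H1 hp₀ (σ := fun t => -2 * (t ^ (2 + 2 * m))⁻¹)
      (fun t ht => ?_) ((hasDerivAt_inv_pow _ ht.ne').const_mul _) ?_
    · rw [ricciHor_profile hA hq1 ht]
      ring
    · have : 0 < -2 * (-((2 + 2 * m : ℕ) : ℝ) * (tCoord p₀ ^ (2 + 2 * m + 1))⁻¹) := by
        rw [neg_mul, neg_mul, mul_neg, neg_neg]
        positivity
      exact this.ne'
  · refine not_isLocallySymmetricOn hm hN hA H1 hp₀ hm0.ne' (fun t ht => ?_)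
      (right_ne_zero_of_mul (hμ1 _ hp₀.2))
    have := hpos t ht
    rw [(hf1 t ht).1, profile_sq this (hq1 t ht), add_comm (2 * m)]
    field_simp
    ring
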